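/- Let $G$ be a connected complex Lie group whose Lie algebra $\mathfrak g$ is simple, and let $M=G/L$ be a homogeneous complex manifold, where $L$, the stabilizer of a point $o\in M$, is connected and its Lie algebra $\mathfrak l$ is a Levi subalgebra of $\mathfrak g$ (the Levi factor of a parabolic subalgebra). Let $\mathfrak h\subset\mathfrak l$ be a Cartan subalgebra of $\mathfrak g$, let $\Omega\subset\mathfrak h^*$ be the set of roots of $\mathfrak g$, $\Omega_{\mathfrak l}\subset\Omega$ the set of roots of $\mathfrak l$, and $\overline\Omega$ (the set of quasiroots) the image of $\Omega$ in $\mathfrak h^*/\mathrm{span}(\Omega_{\mathfrak l})$ with $0$ removed. Let $\overline\Omega^+\subset\overline\Omega$ be a system of positive quasiroots, i.e. $\overline\Omega^+\cap(-\overline\Omega^+)=\varnothing$, $\overline\Omega^+\cup(-\overline\Omega^+)=\overline\Omega$, and $x,y\in\overline\Omega^+$, $x+y\in\overline\Omega$ imply $x+y\in\overline\Omega^+$. Let $\mathfrak m^+\subset\mathfrak g$ be the sum of the root subspaces of all roots whose image lies in $\overline\Omega^+$, and let $T_{\overline\Omega^+}(M)\subset T(M)$ be the subbundle consisting of the images of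 the left translates of $\mathfrak m^+$ under the differential of $\pi:G\to M$, $\pi(g)=g\,o$. Let $\mathcal A$ be the sheaf of holomorphic functions on $M$, with its action of $U(\mathfrak g)$ induced by $(g\cdot a)(x)=a(g^{-1}x)$, and let $\mathcal A_{\overline\Omega^+}\subset\mathcal A$ be the subsheaf of functions $a$ constant along this polarization, i.e. $da(v)=0$ for all $v\in T_{\overline\Omega^+}(M)$. (1) Let $\nu$ be a holomorphic bidifferential operator on $M$ which is $U(\mathfrak g)$-invariant (that is, $u\,\nu(a\otimes b)=\nu(\Delta(u)(a\otimes b))$ for $u\in U(\mathfrak g)$) and vanishes on constants (that is, $\nu(a,b)=0$ if $a$ or $b$ is constant). Then $\nu(a,b)=0$ for all sections $a,b$ of $\mathcal A_{\overline\Omega^+}$ over any open subset of $M$. (2) Let $\Phi_h=\Phi_1\otimes\Phi_2\otimes\Phi_3\in U(\mathfrak g)^{\otimes 3}[[h]]$ (summation implicit; for example, the Drinfeld associator), and let $\mu=\sum_{k\ge 0}h^k\mu_k$ be any $U(\mathfrak g)$-invariant $\Phi_h$-associative quantization of $\mathcal A$: a $\mathbb C[[h]]$-bilinear multiplication on $\mathcal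 A[[h]]$ such that $\mu_0$ is the ordinary multiplication, all $\mu_k$ are $U(\mathfrak g)$-invariant bidifferential operators, those with $k>0$ vanish on constants, and $\mu(\Phi_1x\otimes\mu(\Phi_2y\otimes\Phi_3z))=\mu(\mu(x\otimes y)\otimes z)$ for $x,y,z\in\mathcal A$. Then $\mu(a,b)=ab$ for all sections $a,b$ of $\mathcal A_{\overline\Omega^+}$ over any open subset of $M$. -/

import Mathlib

open scoped Manifold ContDiff Topology PowerSeries TensorProduct
open TopologicalSpace

noncomputable section

/-! ### Derivatives of functions along vector fields -/

section Derivatives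

/-- The derivative `df_p(v)` of a complex valued function `f` along the tangent vector `v`. -/
def dirDeriv {E M : Type*} [NormedAddCommGroup E] [NormedSpace ℂ E]
    [TopologicalSpace M] [ChartedSpace E M] (f : M → ℂ) (p : M)
    (v : TangentSpace 𝓘(ℂ, E) p) : ℂ :=
  mfderiv 𝓘(ℂ, E) 𝓘(ℂ) f p v

open VectorField

variable {E M : Type*} [NormedAddCommGroup E] [NormedSpace ℂ E]
  [TopologicalSpace M] [ChartedSpace E M] [IsManifold 𝓘(ℂ, E) ω M]

theorem fderiv_comp_extChartAt_symm {h : M → ℂ} {x : M} {y : E}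
    (hy : y ∈ (extChartAt 𝓘(ℂ, E) x).target)
    (hh : MDifferentiableAt 𝓘(ℂ, E) 𝓘(ℂ) h ((extChartAt 𝓘(ℂ, E) x).symm y))
    (W : Π p : M, TangentSpace 𝓘(ℂ, E) p) :
    fderiv ℂ (h ∘ (extChartAt 𝓘(ℂ, E) x).symm) y
      (mpullbackWithin 𝓘(ℂ, E) 𝓘(ℂ, E) (extChartAt 𝓘(ℂ, E) x).symm W Set.univ y) =
    dirDeriv h ((extChartAt 𝓘(ℂ, E) x).symm y)
      (W ((extChartAt 𝓘(ℂ, E) x).symm y)) := by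
  have hinv := isInvertible_mfderivWithin_extChartAt_symm (I := 𝓘(ℂ, E)) hy
  have hs : MDifferentiableAt 𝓘(ℂ, E) 𝓘(ℂ, E) (extChartAt 𝓘(ℂ, E) x).symm y := by
    have := mdifferentiableWithinAt_extChartAt_symm (I := 𝓘(ℂ, E)) hy
    rwa [ModelWithCorners.range_eq_univ, mdifferentiableWithinAt_univ] at this
  rw [← mfderiv_eq_fderiv, mfderiv_comp y hh hs]
  simp only [ModelWithCorners.range_eq_univ, mfderivWithin_univ] at hinv
  simp only [mpullbackWithin, mfderivWithin_univ]
  obtain ⟨e, he⟩ := hinv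
  change (mfderiv 𝓘(ℂ, E) 𝓘(ℂ) h _) (mfderiv 𝓘(ℂ, E) 𝓘(ℂ, E) (extChartAt 𝓘(ℂ, E) x).symm y
    (ContinuousLinearMap.inverse _ _)) = _
  rw [← he, ContinuousLinearMap.inverse_equiv]
  exact congrArg _ (e.apply_symm_apply _)

/-- The derivative along the bracket `[V, W]` is the commutator of the derivatives along `V` and
`W`. -/
theorem mfderiv_mlieBracket_apply [CompleteSpace E] {f : M → ℂ} {x : M} (hf : ContMDiffAt 𝓘(ℂ, E) 𝓘(ℂ) ω f x)
    {V W : Π p : M, TangentSpace 𝓘(ℂ, E) p}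
    (hV : MDifferentiableAt 𝓘(ℂ, E) 𝓘(ℂ, E).tangent (fun p ↦ (V p : TangentBundle 𝓘(ℂ, E) M)) x)
    (hW : MDifferentiableAt 𝓘(ℂ, E) 𝓘(ℂ, E).tangent (fun p ↦ (W p : TangentBundle 𝓘(ℂ, E) M)) x) :
    dirDeriv f x (mlieBracket 𝓘(ℂ, E) V W x) =
      dirDeriv (fun p ↦ dirDeriv f p (W p)) x (V x) -
      dirDeriv (fun p ↦ dirDeriv f p (V p)) x (W x) := by
  have : IsManifold 𝓘(ℂ, E) 2 M := IsManifold.of_le (n := ω) le_top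
  have : IsManifold 𝓘(ℂ, E) 1 M := IsManifold.of_le (n := ω) le_top
  set φ := extChartAt 𝓘(ℂ, E) x with hφ
  have hxt : φ x ∈ φ.target := mem_extChartAt_target x
  have hxx : φ.symm (φ x) = x := extChartAt_to_inv x
  have htn : φ.target ∈ 𝓝 (φ x) := extChartAt_target_mem_nhds x
  let V' : E → E := mpullbackWithin 𝓘(ℂ, E) 𝓘(ℂ, E) φ.symm V Set.univ
  let W' : E → E := mpullbackWithin 𝓘(ℂ, E) 𝓘(ℂ, E) φ.symm W Set.univ
  have diff : ∀ {V : Π p : M, TangentSpace 𝓘(ℂ, E) p},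
      MDifferentiableAt 𝓘(ℂ, E) 𝓘(ℂ, E).tangent (fun p ↦ (V p : TangentBundle 𝓘(ℂ, E) M)) x →
      DifferentiableAt ℂ (mpullbackWithin 𝓘(ℂ, E) 𝓘(ℂ, E) φ.symm V Set.univ) (φ x) := by
    intro V hV
    have := MDifferentiableWithinAt.differentiableWithinAt_mpullbackWithin_vectorField
      (s := Set.univ) hV.mdifferentiableWithinAt
    rw [Set.preimage_univ, Set.univ_inter, ModelWithCorners.range_eq_univ] at this
    exact (differentiableWithinAt_univ (𝕜 := ℂ) (E := E) (F := E)).1 this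
  have hfs : ContDiffAt ℂ ω (f ∘ φ.symm) (φ x) := by
    have h1 : ContMDiffAt 𝓘(ℂ, E) 𝓘(ℂ, E) ω φ.symm (φ x) := by
      have := contMDiffOn_extChartAt_symm (I := 𝓘(ℂ, E)) (n := ω) x
      exact this.contMDiffAt htn
    have h2 : ContMDiffAt 𝓘(ℂ, E) 𝓘(ℂ) ω f (φ.symm (φ x)) := by rwa [hxx]
    exact (h2.comp _ h1).contDiffAt
  have hev : ∀ᶠ y in 𝓝 (φ x), MDifferentiableAt 𝓘(ℂ, E) 𝓘(ℂ) f (φ.symm y) := by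
    have h1 : ∀ᶠ p in 𝓝 x, ContMDiffAt 𝓘(ℂ, E) 𝓘(ℂ) 1 f p :=
      (contMDiffAt_iff_contMDiffAt_nhds (by simp)).1 (ContMDiffAt.of_le (n := ω) (m := 1) hf le_top)
    have h2 : Filter.Tendsto φ.symm (𝓝 (φ x)) (𝓝 x) := by
      have := (continuousAt_extChartAt_symm (I := 𝓘(ℂ, E)) x).tendsto
      rwa [hxx] at this
    filter_upwards [h2.eventually h1] with y hy using hy.mdifferentiableAt one_ne_zero
  have key : ∀ {W : Π p : M, TangentSpace 𝓘(ℂ, E) p},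
      (fun y ↦ fderiv ℂ (f ∘ φ.symm) y
        (mpullbackWithin 𝓘(ℂ, E) 𝓘(ℂ, E) φ.symm W Set.univ y)) =ᶠ[𝓝 (φ x)]
      ((fun p ↦ dirDeriv f p (W p)) ∘ φ.symm) := by
    intro W
    filter_upwards [htn, hev] with y hy hy2
    exact fderiv_comp_extChartAt_symm hy hy2 W
  have second : ∀ {V W : Π p : M, TangentSpace 𝓘(ℂ, E) p},
      MDifferentiableAt 𝓘(ℂ, E) 𝓘(ℂ, E).tangent (fun p ↦ (W p : TangentBundle 𝓘(ℂ, E) M)) x →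
      fderiv ℂ (fun y ↦ fderiv ℂ (f ∘ φ.symm) y
        (mpullbackWithin 𝓘(ℂ, E) 𝓘(ℂ, E) φ.symm W Set.univ y)) (φ x)
        (mpullbackWithin 𝓘(ℂ, E) 𝓘(ℂ, E) φ.symm V Set.univ (φ x)) =
      dirDeriv (fun p ↦ dirDeriv f p (W p)) x (V x) := by
    intro V W hW
    have hd : DifferentiableAt ℂ (fun y ↦ fderiv ℂ (f ∘ φ.symm) y
        (mpullbackWithin 𝓘(ℂ, E) 𝓘(ℂ, E) φ.symm W Set.univ y)) (φ x) := by
      have h3 : DifferentiableAt ℂ (fderiv ℂ (f ∘ φ.symm)) (φ x) :=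
        (hfs.fderiv_right (m := 1) (by exact le_top)).differentiableAt one_ne_zero
      exact h3.clm_apply (diff hW)
    have hd2 := key.differentiableAt_iff.1 hd
    have hd3 : MDifferentiableAt 𝓘(ℂ, E) 𝓘(ℂ)
        (fun p ↦ dirDeriv f p (W p)) x := by
      have h4 : MDifferentiableAt 𝓘(ℂ, E) 𝓘(ℂ, E) φ x :=
        mdifferentiableAt_extChartAt (mem_chart_source _ x)
      have h5 := hd2.mdifferentiableAt.comp x h4
      refine h5.congr_of_eventuallyEq ?_
      filter_upwards [extChartAt_source_mem_nhds (I := 𝓘(ℂ, E)) x] with p hp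
      simp only [Function.comp]
      rw [φ.left_inv hp]
    rw [key.fderiv_eq, fderiv_comp_extChartAt_symm hxt (by rw [hxx]; exact hd3)]
    rw [hxx]
  have main := fderiv_apply_lieBracket (𝕜 := ℂ) (V := V') (W := W') hfs (by simp) (diff hW) (diff hV)
  rw [second hW, second hV] at main
  rw [← main]
  have hbr : mlieBracket 𝓘(ℂ, E) V W x =
      (mfderiv 𝓘(ℂ, E) 𝓘(ℂ, E) φ x).inverse (lieBracket ℂ V' W' (φ x) : E) := by
    rw [← mlieBracketWithin_univ, mlieBracketWithin_apply]
    simp only [ModelWithCorners.range_eq_univ, Set.preimage_univ, Set.inter_univ]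
    exact congrArg _ (congrFun (lieBracketWithin_univ (𝕜 := ℂ) (V := V') (W := W')) (φ x))
  rw [hbr]
  have hd : MDifferentiableAt 𝓘(ℂ, E) 𝓘(ℂ) f x := hf.mdifferentiableAt (by simp)
  have hinv := isInvertible_mfderiv_extChartAt (I := 𝓘(ℂ, E)) (mem_extChartAt_source x)
  have h4 : MDifferentiableAt 𝓘(ℂ, E) 𝓘(ℂ, E) φ x :=
        mdifferentiableAt_extChartAt (mem_chart_source _ x)
  have hff : f =ᶠ[𝓝 x] (f ∘ φ.symm) ∘ φ := by
    filter_upwards [extChartAt_source_mem_nhds (I := 𝓘(ℂ, E)) x] with p hp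
    simp only [Function.comp]
    rw [φ.left_inv hp]
  unfold dirDeriv
  rw [hff.mfderiv_eq, mfderiv_comp x (hfs.differentiableAt (by simp)).mdifferentiableAt h4]
  obtain ⟨e, he⟩ := hinv
  change (mfderiv 𝓘(ℂ, E) 𝓘(ℂ) (f ∘ φ.symm) (φ x)) (mfderiv 𝓘(ℂ, E) 𝓘(ℂ, E) φ x
    (ContinuousLinearMap.inverse _ _)) = _
  rw [← hφ] at he
  rw [← he, mfderiv_eq_fderiv, ContinuousLinearMap.inverse_equiv]
  exact congrArg _ (e.apply_symm_apply _)
end Derivatives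

/-! ### The structure sheaf and the action of the Lie algebra -/

section Action

attribute [local instance] LieRing.ofAssociativeRing

variable {E F G M : Type*}
  [NormedAddCommGroup E] [NormedSpace ℂ E]
  [NormedAddCommGroup F] [NormedSpace ℂ F]
  [TopologicalSpace G] [ChartedSpace E G] [Group G]
  [TopologicalSpace M] [ChartedSpace F M]

/-- The algebra `𝒜(U)` of holomorphic (complex analytic) functions on the open set `U ⊆ M`. -/
abbrev HolFun (F : Type*) [NormedAddCommGroup F] [NormedSpace ℂ F]
    {M : Type*} [TopologicalSpace M] [ChartedSpace F M] (U : Opens M) : Type _ :=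
  C^ω⟮𝓘(ℂ, F), U; 𝓘(ℂ), ℂ⟯

/-- The extension by zero of `a ∈ 𝒜(U)` to a function on all of `M`; it is only ever used near
points of `U`. -/
def HolFun.ext {U : Opens M} (a : HolFun F U) : M → ℂ :=
  Function.extend Subtype.val a 0

theorem HolFun.ext_apply {U : Opens M} (a : HolFun F U) {x : M} (hx : x ∈ U) :
    a.ext x = a ⟨x, hx⟩ :=
  Subtype.val_injective.extend_apply (⇑a) 0 (⟨x, hx⟩ : U)

theorem HolFun.contMDiffAt_ext {U : Opens M} (a : HolFun F U) {x : M} (hx : x ∈ U) :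
    ContMDiffAt 𝓘(ℂ, F) 𝓘(ℂ) ω a.ext x := by
  have h : ContMDiffAt 𝓘(ℂ, F) 𝓘(ℂ) ω (fun y : U ↦ a.ext y) ⟨x, hx⟩ := by
    have : (fun y : U ↦ a.ext y) = a := by
      ext y
      exact a.ext_apply y.2
    rw [this]
    exact a.contMDiff _
  exact contMDiffAt_subtype_iff.1 h

variable [MulAction G M]

/-- The value at `x` of `X · a`, for `X` in the Lie algebra of `G`: the derivative at `g = 1`, in
the direction `X`, of `(g · a)(x) = a(g⁻¹ x)`. -/
def lieActFun {U : Opens M} (X : GroupLieAlgebra 𝓘(ℂ, E) G) (a : HolFun F U) (x : M) : ℂ :=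
  dirDeriv (fun g : G ↦ a.ext (g⁻¹ • x)) 1 X

variable [LieGroup 𝓘(ℂ, E) ω G] [ContMDiffSMul 𝓘(ℂ, E) 𝓘(ℂ, F) ω G M]

theorem contMDiff_inv_smul :
    ContMDiff (𝓘(ℂ, F).prod 𝓘(ℂ, E)) 𝓘(ℂ, F) ω (fun p : M × G ↦ p.2⁻¹ • p.1) := by
  have h1 : ContMDiff (𝓘(ℂ, F).prod 𝓘(ℂ, E)) (𝓘(ℂ, E).prod 𝓘(ℂ, F)) ω
      (fun p : M × G ↦ (p.2⁻¹, p.1)) :=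
    ((contMDiff_inv 𝓘(ℂ, E) ω).comp contMDiff_snd).prodMk contMDiff_fst
  exact (ContMDiffSMul.contMDiff_smul (I := 𝓘(ℂ, E)) (I' := 𝓘(ℂ, F)) (n := ω)).comp h1

theorem contMDiffAt_orbitFun {U : Opens M} (a : HolFun F U) {x : M} {g : G} (hx : g⁻¹ • x ∈ U) :
    ContMDiffAt (𝓘(ℂ, F).prod 𝓘(ℂ, E)) 𝓘(ℂ) ω
      (Function.uncurry fun (y : M) (k : G) ↦ a.ext (k⁻¹ • y)) (x, g) :=
  ContMDiffAt.comp (x, g) (a.contMDiffAt_ext hx) (contMDiff_inv_smul (E := E)).contMDiffAt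

theorem contMDiffAt_orbitFun_right {U : Opens M} (a : HolFun F U) {x : M} {g : G}
    (hx : g⁻¹ • x ∈ U) :
    ContMDiffAt 𝓘(ℂ, E) 𝓘(ℂ) ω (fun k : G ↦ a.ext (k⁻¹ • x)) g := by
  have h : ContMDiffAt 𝓘(ℂ, E) (𝓘(ℂ, F).prod 𝓘(ℂ, E)) ω (fun k : G ↦ (x, k)) g :=
    contMDiffAt_const.prodMk contMDiffAt_id
  exact ContMDiffAt.comp (g := Function.uncurry fun (y : M) (k : G) ↦ a.ext (k⁻¹ • y)) g
    (contMDiffAt_orbitFun (E := E) a hx) h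

theorem contMDiffAt_lieActFun [IsManifold 𝓘(ℂ, F) ω M] {U : Opens M}
    (X : GroupLieAlgebra 𝓘(ℂ, E) G) (a : HolFun F U) {x : M} (hx : x ∈ U) :
    ContMDiffAt 𝓘(ℂ, F) 𝓘(ℂ) ω (lieActFun X a) x := by
  have : IsManifold 𝓘(ℂ, F) 1 M := IsManifold.of_le (n := ω) le_top
  have : LieGroup 𝓘(ℂ, E) 1 G := inferInstance
  have : IsManifold 𝓘(ℂ, E) 1 G := this.toIsManifold
  have hx' : (1 : G)⁻¹ • x ∈ U := by simpa using hx
  have key := ContMDiffAt.mfderiv (I := 𝓘(ℂ, E)) (I' := 𝓘(ℂ)) (J := 𝓘(ℂ, F)) (n := ω) (m := ω)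
    (x₀ := x) (fun (y : M) (k : G) ↦ a.ext (k⁻¹ • y)) (fun _ ↦ (1 : G))
    (contMDiffAt_orbitFun (E := E) a hx') contMDiffAt_const le_top
  have key2 := key.clm_apply (contMDiffAt_const (M' := E) (c := X))
  refine key2.congr_of_eventuallyEq ?_
  filter_upwards with y
  let ψ : M → E →L[ℂ] ℂ := fun z ↦ mfderiv 𝓘(ℂ, E) 𝓘(ℂ) (fun k : G ↦ a.ext (k⁻¹ • z)) 1
  have e : inTangentCoordinates 𝓘(ℂ, E) 𝓘(ℂ) (fun _ : M ↦ (1 : G))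
      (fun z : M ↦ a.ext ((1 : G)⁻¹ • z)) ψ x y = ψ y := by
    rw [inTangentCoordinates_eq (x₀ := x) (x := y) _ _ _ (mem_chart_source E (1 : G))
      (by rw [chartAt_self_eq]; trivial)]
    ext v
    rw [ContinuousLinearMap.comp_apply, ContinuousLinearMap.comp_apply,
      VectorBundleCore.coordChange_self _ _ _ (mem_chart_source _ _)]
    simp
  exact (congrArg (fun l : E →L[ℂ] ℂ ↦ l X) e).symm

theorem dirDeriv_orbitFun {U : Opens M} (X : GroupLieAlgebra 𝓘(ℂ, E) G) (a : HolFun F U) {x : M}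
    {g : G} (hx : g⁻¹ • x ∈ U) :
    dirDeriv (fun k : G ↦ a.ext (k⁻¹ • x)) g (mulInvariantVectorField X g) =
      lieActFun X a (g⁻¹ • x) := by
  have h1 : MDifferentiableAt 𝓘(ℂ, E) 𝓘(ℂ) (fun k : G ↦ a.ext (k⁻¹ • x)) (g * 1) := by
    rw [mul_one]
    exact (contMDiffAt_orbitFun_right (E := E) a hx).mdifferentiableAt (by simp)
  have h2 : MDifferentiableAt 𝓘(ℂ, E) 𝓘(ℂ, E) (fun k : G ↦ g * k) 1 :=
    (contMDiff_mul_left (I := 𝓘(ℂ, E)) (n := ω)).contMDiffAt.mdifferentiableAt (by simp)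
  have h3 : (fun k : G ↦ a.ext (k⁻¹ • g⁻¹ • x)) =
      (fun k : G ↦ a.ext (k⁻¹ • x)) ∘ (fun k : G ↦ g * k) := by
    ext k
    simp [mul_smul]
  unfold lieActFun dirDeriv
  rw [h3, mfderiv_comp 1 h1 h2]
  unfold mulInvariantVectorField
  have h4 : g * 1 = g := mul_one g
  rw [ContinuousLinearMap.comp_apply]
  congr 1
  rw [h4]

variable [IsManifold 𝓘(ℂ, F) ω M]

/-- The action of an element `X` of the Lie algebra of `G` on `𝒜(U)`. -/
def lieAct {U : Opens M} (X : GroupLieAlgebra 𝓘(ℂ, E) G) (a : HolFun F U) : HolFun F U :=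
  ⟨fun x ↦ lieActFun X a x, fun x ↦ contMDiffAt_subtype_iff.2 (contMDiffAt_lieActFun X a x.2)⟩

theorem lieAct_apply {U : Opens M} (X : GroupLieAlgebra 𝓘(ℂ, E) G) (a : HolFun F U) (x : U) :
    lieAct X a x = lieActFun X a x := rfl

theorem lieAct_add_right {U : Opens M} (X : GroupLieAlgebra 𝓘(ℂ, E) G) (a b : HolFun F U) :
    lieAct X (a + b) = lieAct X a + lieAct X b := by
  ext x
  have hx : (1 : G)⁻¹ • (x : M) ∈ U := by simp
  have ha := (contMDiffAt_orbitFun_right (E := E) a hx).mdifferentiableAt (by simp)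
  have hb := (contMDiffAt_orbitFun_right (E := E) b hx).mdifferentiableAt (by simp)
  have h : (fun k : G ↦ (a + b).ext (k⁻¹ • (x : M))) =ᶠ[𝓝 1]
      (fun k : G ↦ a.ext (k⁻¹ • (x : M))) + (fun k : G ↦ b.ext (k⁻¹ • (x : M))) := by
    have hc : ContinuousAt (fun k : G ↦ k⁻¹ • (x : M)) 1 := by
      have h2 : ContMDiff 𝓘(ℂ, E) (𝓘(ℂ, F).prod 𝓘(ℂ, E)) ω (fun k : G ↦ ((x : M), k)) :=
        contMDiff_const.prodMk contMDiff_id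
      exact ((contMDiff_inv_smul (E := E) (F := F)).comp h2).continuous.continuousAt
    filter_upwards [hc.preimage_mem_nhds (U.isOpen.mem_nhds hx)] with k hk
    simp only [Pi.add_apply]
    rw [HolFun.ext_apply _ hk, HolFun.ext_apply _ hk, HolFun.ext_apply _ hk]
    rfl
  change dirDeriv _ _ _ = dirDeriv _ _ _ + dirDeriv _ _ _
  unfold dirDeriv
  rw [h.mfderiv_eq, mfderiv_add ha hb]
  rfl

theorem lieAct_smul_right {U : Opens M} (X : GroupLieAlgebra 𝓘(ℂ, E) G) (c : ℂ)
    (a : HolFun F U) : lieAct X (c • a) = c • lieAct X a := by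
  ext x
  have hx : (1 : G)⁻¹ • (x : M) ∈ U := by simp
  have ha := (contMDiffAt_orbitFun_right (E := E) a hx).mdifferentiableAt (by simp)
  have h : (fun k : G ↦ (c • a).ext (k⁻¹ • (x : M))) =
      c • (fun k : G ↦ a.ext (k⁻¹ • (x : M))) := by
    ext k
    by_cases hk : k⁻¹ • (x : M) ∈ U
    · simp only [Pi.smul_apply]
      rw [HolFun.ext_apply _ hk, HolFun.ext_apply _ hk]
      rfl
    · have hn : ¬ ∃ y : U, (y : M) = k⁻¹ • (x : M) := by
        rintro ⟨y, hy⟩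
        exact hk (hy ▸ y.2)
      simp [HolFun.ext, Function.extend_apply' _ _ _ hn]
  change dirDeriv _ _ _ = c • dirDeriv _ _ _
  unfold dirDeriv
  rw [h, const_smul_mfderiv ha]
  rfl

/-- The action map from the Lie algebra of `G` to the operators on `𝒜(U)`, as a homomorphism of
Lie algebras. -/
def lieRep [CompleteSpace E] (U : Opens M) :
    GroupLieAlgebra 𝓘(ℂ, E) G →ₗ⁅ℂ⁆ Module.End ℂ (HolFun F U) where
  toFun X :=
    { toFun := lieAct X
      map_add' := lieAct_add_right X
      map_smul' := lieAct_smul_right X }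
  map_add' X Y := by
    ext a x
    exact map_add (mfderiv 𝓘(ℂ, E) 𝓘(ℂ) (fun g : G ↦ a.ext (g⁻¹ • (x : M))) 1) X Y
  map_smul' c X := by
    ext a x
    exact map_smul (mfderiv 𝓘(ℂ, E) 𝓘(ℂ) (fun g : G ↦ a.ext (g⁻¹ • (x : M))) 1) c X
  map_lie' {X Y} := by
    ext a x
    have hx : (1 : G)⁻¹ • (x : M) ∈ U := by simp
    have hev : ∀ᶠ g : G in 𝓝 1, g⁻¹ • (x : M) ∈ U := by
      have hc : ContinuousAt (fun k : G ↦ k⁻¹ • (x : M)) 1 := by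
        have h2 : ContMDiff 𝓘(ℂ, E) (𝓘(ℂ, F).prod 𝓘(ℂ, E)) ω (fun k : G ↦ ((x : M), k)) :=
          contMDiff_const.prodMk contMDiff_id
        exact ((contMDiff_inv_smul (E := E) (F := F)).comp h2).continuous.continuousAt
      exact hc.preimage_mem_nhds (U.isOpen.mem_nhds hx)
    have hone : ∀ Z : GroupLieAlgebra 𝓘(ℂ, E) G, mulInvariantVectorField Z (1 : G) = Z := by
      intro Z
      have : (fun k : G ↦ 1 * k) = id := by ext; simp
      change (mfderiv 𝓘(ℂ, E) 𝓘(ℂ, E) (fun k : G ↦ 1 * k) 1 : E →L[ℂ] E) Z = Z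
      rw [this, mfderiv_id]
      rfl
    have two : ∀ X Y : GroupLieAlgebra 𝓘(ℂ, E) G, lieAct X (lieAct Y a) x =
        dirDeriv (fun g : G ↦ dirDeriv (fun k : G ↦ a.ext (k⁻¹ • (x : M))) g
          (mulInvariantVectorField Y g)) 1 (mulInvariantVectorField X 1) := by
      intro X Y
      rw [lieAct_apply, hone]
      unfold lieActFun
      have he : (fun g : G ↦ (lieAct Y a).ext (g⁻¹ • (x : M))) =ᶠ[𝓝 1]
          (fun g : G ↦ dirDeriv (fun k : G ↦ a.ext (k⁻¹ • (x : M))) g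
          (mulInvariantVectorField Y g)) := by
        filter_upwards [hev] with g hg
        rw [dirDeriv_orbitFun Y a hg, HolFun.ext_apply _ hg]
        rfl
      unfold dirDeriv at he ⊢
      rw [he.mfderiv_eq]
      rfl
    have main := mfderiv_mlieBracket_apply (E := E) (M := G)
      (contMDiffAt_orbitFun_right (E := E) a hx)
      (mdifferentiableAt_mulInvariantVectorField (I := 𝓘(ℂ, E)) X)
      (mdifferentiableAt_mulInvariantVectorField (I := 𝓘(ℂ, E)) Y)
    rw [← two, ← two] at main
    exact main

/-- The action of the universal enveloping algebra `U(𝔤)` on `𝒜(U)`. -/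
def envRep (E : Type*) [NormedAddCommGroup E] [NormedSpace ℂ E] [CompleteSpace E]
    (G : Type*) [TopologicalSpace G] [ChartedSpace E G] [Group G] [LieGroup 𝓘(ℂ, E) ω G]
    {F M : Type*} [NormedAddCommGroup F] [NormedSpace ℂ F] [TopologicalSpace M]
    [ChartedSpace F M] [IsManifold 𝓘(ℂ, F) ω M] [MulAction G M]
    [ContMDiffSMul 𝓘(ℂ, E) 𝓘(ℂ, F) ω G M] (U : Opens M) :
    UniversalEnvelopingAlgebra ℂ (GroupLieAlgebra 𝓘(ℂ, E) G) →ₐ[ℂ] Module.End ℂ (HolFun F U) :=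
  UniversalEnvelopingAlgebra.lift ℂ (lieRep (E := E) (G := G) U)

end Action

section Comul

attribute [local instance] LieRing.ofAssociativeRing

variable (L : Type*) [LieRing L] [LieAlgebra ℂ L]

/-- The comultiplication `Δ : U(L) → U(L) ⊗ U(L)`, determined by `Δ X = X ⊗ 1 + 1 ⊗ X` for
`X ∈ L`. -/
def envComul : UniversalEnvelopingAlgebra ℂ L →ₐ[ℂ]
    UniversalEnvelopingAlgebra ℂ L ⊗[ℂ] UniversalEnvelopingAlgebra ℂ L :=
  UniversalEnvelopingAlgebra.lift ℂ
    { toFun := fun X ↦ UniversalEnvelopingAlgebra.ι ℂ X ⊗ₜ 1 + 1 ⊗ₜ UniversalEnvelopingAlgebra.ι ℂ X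
      map_add' := by
        intro X Y
        simp only [map_add, TensorProduct.add_tmul, TensorProduct.tmul_add]
        abel
      map_smul' := by
        intro c X
        simp [TensorProduct.smul_tmul']
      map_lie' := by
        intro X Y
        simp only [LieHom.map_lie, LieRing.of_associative_ring_bracket, TensorProduct.sub_tmul,
          TensorProduct.tmul_sub, add_mul, mul_add, Algebra.TensorProduct.tmul_mul_tmul, one_mul,
          mul_one]
        abel }

end Comul

/-! ### Bidifferential operators and formal multiplications -/

section Operators

instance powerSeriesScalarTower (A : Type*) [CommRing A] [Algebra ℂ A] :
    IsScalarTower ℂ ℂ⟦X⟧ A⟦X⟧ := by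
  refine ⟨fun c f x ↦ ?_⟩
  rw [PowerSeries.smul_eq_C_mul, mul_smul, Algebra.smul_def (PowerSeries.C c),
    PowerSeries.algebraMap_apply'', PowerSeries.map_C, ← PowerSeries.smul_eq_C_mul,
    algebraMap_smul]

/-- A (holomorphic) bidifferential operator on `M`: a family of bilinear maps
`𝒜(U) × 𝒜(U) → 𝒜(U)` which near every point `x` is given, in the chart at `x`, by one and the same
formula `∑_{i, j ≤ k} C_{ij} (Dⁱ a) (Dʲ b)` for all `U`, where `Dⁱ a` is the `i`-th derivative of
`a` in the chart, and the coefficients `C_{ij}` (which pair the `i`-th derivative of the first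
argument with the `j`-th derivative of the second one) are holomorphic. The local formula forces
the compatibility with restrictions to smaller open sets. (`F` is meant to be finite-dimensional;
then this is the usual formula with partial derivatives.) -/
structure BidiffOp (F : Type*) [NormedAddCommGroup F] [NormedSpace ℂ F]
    (M : Type*) [TopologicalSpace M] [ChartedSpace F M] where
  op : ∀ U : Opens M, HolFun F U →ₗ[ℂ] HolFun F U →ₗ[ℂ] HolFun F U
  local_formula : ∀ x : M, ∃ V : Opens M, x ∈ V ∧ (V : Set M) ⊆ (chartAt F x).source ∧
    ∃ (k : ℕ) (C : ∀ i j : ℕ, F → (F [×i]→L[ℂ] ℂ) →ₗ[ℂ] (F [×j]→L[ℂ] ℂ) →ₗ[ℂ] ℂ),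
      (∀ i j p q, AnalyticOnNhd ℂ (fun z ↦ C i j z p q) (chartAt F x '' V)) ∧
      ∀ (U : Opens M) (a b : HolFun F U) (y : U), (y : M) ∈ V →
        op U a b y = ∑ i ∈ Finset.range (k + 1), ∑ j ∈ Finset.range (k + 1),
          C i j (chartAt F x y)
            (iteratedFDeriv ℂ i (a.ext ∘ (chartAt F x).symm) (chartAt F x y))
            (iteratedFDeriv ℂ j (b.ext ∘ (chartAt F x).symm) (chartAt F x y))

/-- The operator is zero as soon as one of its arguments is a constant function. -/
def BidiffOp.VanishesOnConstants {F : Type*} [NormedAddCommGroup F] [NormedSpace ℂ F]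
    {M : Type*} [TopologicalSpace M] [ChartedSpace F M] (ν : BidiffOp F M) : Prop :=
  ∀ (U : Opens M) (c : ℂ) (a : HolFun F U),
    ν.op U (algebraMap ℂ (HolFun F U) c) a = 0 ∧ ν.op U a (algebraMap ℂ (HolFun F U) c) = 0

variable (E : Type*) [NormedAddCommGroup E] [NormedSpace ℂ E] [CompleteSpace E]
  (G : Type*) [TopologicalSpace G] [ChartedSpace E G] [Group G] [LieGroup 𝓘(ℂ, E) ω G]
  {F M : Type*} [NormedAddCommGroup F] [NormedSpace ℂ F] [TopologicalSpace M]
  [ChartedSpace F M] [IsManifold 𝓘(ℂ, F) ω M] [MulAction G M]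
  [ContMDiffSMul 𝓘(ℂ, E) 𝓘(ℂ, F) ω G M]

/-- The universal enveloping algebra of the Lie algebra of `G`. -/
abbrev EnvAlg : Type _ := UniversalEnvelopingAlgebra ℂ (GroupLieAlgebra 𝓘(ℂ, E) G)

/-- The linear map `u ↦ u · a` from `U(𝔤)` to `𝒜(U)`. -/
def envOrbit {U : Opens M} (a : HolFun F U) : EnvAlg E G →ₗ[ℂ] HolFun F U :=
  (LinearMap.applyₗ a).comp (envRep E G U).toLinearMap

/-- `U(𝔤)`-invariance of a bidifferential operator: `u · ν(a ⊗ b) = ν(Δ(u) · (a ⊗ b))`. -/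
def BidiffOp.IsInvariant (ν : BidiffOp F M) : Prop :=
  ∀ (U : Opens M) (u : EnvAlg E G) (a b : HolFun F U),
    envRep E G U u (ν.op U a b) =
      TensorProduct.lift ((ν.op U).compl₁₂ (envOrbit E G a) (envOrbit E G b))
        (envComul (GroupLieAlgebra 𝓘(ℂ, E) G) u)

variable {E G} in
/-- For a `ℂ⟦h⟧`-bilinear map `μ` on `𝒜(U)⟦h⟧` and `x, y, z ∈ 𝒜(U)`, the linear map
`u ⊗ v ⊗ w ↦ μ(u · x, μ(v · y, w · z))` on `U(𝔤) ⊗ U(𝔤) ⊗ U(𝔤)`. -/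
def assocTerm {U : Opens M}
    (μ : (HolFun F U)⟦X⟧ →ₗ[ℂ⟦X⟧] (HolFun F U)⟦X⟧ →ₗ[ℂ⟦X⟧] (HolFun F U)⟦X⟧)
    (x y z : HolFun F U) :
    EnvAlg E G ⊗[ℂ] (EnvAlg E G ⊗[ℂ] EnvAlg E G) →ₗ[ℂ] (HolFun F U)⟦X⟧ :=
  let m : (HolFun F U)⟦X⟧ →ₗ[ℂ] (HolFun F U)⟦X⟧ →ₗ[ℂ] (HolFun F U)⟦X⟧ :=
    μ.restrictScalars₁₂ ℂ ℂ
  let c : HolFun F U →ₗ[ℂ] (HolFun F U)⟦X⟧ := (PowerSeries.monomial 0).restrictScalars ℂ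
  TensorProduct.lift (m.compl₁₂ (c.comp (envOrbit E G x))
    (TensorProduct.lift (m.compl₁₂ (c.comp (envOrbit E G y)) (c.comp (envOrbit E G z)))))

/-- A `Φ`-associative quantization of the sheaf `𝒜`, for `Φ = ∑ hᵏ Φ_k ∈ U(𝔤)^{⊗3}⟦h⟧` (the formal
parameter `h` is the variable of the power series): a `ℂ⟦h⟧`-bilinear multiplication
`μ = ∑ hᵏ μ_k` on `𝒜⟦h⟧`, where `μ_0` is the ordinary multiplication, all `μ_k` are bidifferential
operators, vanishing on constants for `k > 0`, and
`μ(Φ₁ x ⊗ μ(Φ₂ y ⊗ Φ₃ z)) = μ(μ(x ⊗ y) ⊗ z)` for `x, y, z ∈ 𝒜`. -/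
structure PhiQuantization (F : Type*) [NormedAddCommGroup F] [NormedSpace ℂ F]
    (M : Type*) [TopologicalSpace M] [ChartedSpace F M] [IsManifold 𝓘(ℂ, F) ω M]
    [MulAction G M] [ContMDiffSMul 𝓘(ℂ, E) 𝓘(ℂ, F) ω G M]
    (Φ : (EnvAlg E G ⊗[ℂ] (EnvAlg E G ⊗[ℂ] EnvAlg E G))⟦X⟧) where
  mul : ∀ U : Opens M,
    (HolFun F U)⟦X⟧ →ₗ[ℂ⟦X⟧] (HolFun F U)⟦X⟧ →ₗ[ℂ⟦X⟧] (HolFun F U)⟦X⟧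
  term : ℕ → BidiffOp F M
  mul_eq : ∀ (U : Opens M) (a b : HolFun F U),
    mul U (PowerSeries.C a) (PowerSeries.C b) = PowerSeries.mk fun k ↦ (term k).op U a b
  term_zero : ∀ (U : Opens M) (a b : HolFun F U), (term 0).op U a b = a * b
  term_vanishes : ∀ k, 0 < k → (term k).VanishesOnConstants
  assoc : ∀ (U : Opens M) (x y z : HolFun F U),
    (PowerSeries.mk fun n ↦ ∑ p ∈ Finset.HasAntidiagonal.antidiagonal n,
      PowerSeries.coeff p.2 (assocTerm (mul U) x y z (PowerSeries.coeff p.1 Φ))) =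
    mul U (mul U (PowerSeries.C x) (PowerSeries.C y)) (PowerSeries.C z)

variable {E G} in
/-- `U(𝔤)`-invariance of a quantization; `U(𝔤)` acts on `𝒜⟦h⟧` coefficientwise, so this is the
invariance of all coefficients. -/
def PhiQuantization.IsInvariant {Φ : (EnvAlg E G ⊗[ℂ] (EnvAlg E G ⊗[ℂ] EnvAlg E G))⟦X⟧}
    (μ : PhiQuantization E G F M Φ) : Prop :=
  ∀ k, (μ.term k).IsInvariant E G

end Operators

/-! ### Levi subalgebras and quasiroots -/

section Roots

open scoped Pointwise

variable {L : Type*} [LieRing L] [LieAlgebra ℂ L]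
  (H : LieSubalgebra ℂ L) [H.IsCartanSubalgebra]

/-- The root subspace of `α ∈ H*`. -/
def rootSub (α : Module.Dual ℂ H) : Submodule ℂ L :=
  (LieAlgebra.rootSpace H α).toSubmodule

/-- The set `Ω` of roots with respect to `H`. -/
def rootSet : Set (Module.Dual ℂ H) :=
  {α | α ≠ 0 ∧ rootSub H α ≠ ⊥}

/-- `𝔩` is a Levi subalgebra containing the Cartan subalgebra `H`: the Levi factor of a parabolic
subalgebra `𝔭`. A subalgebra `𝔭 ⊇ H` is parabolic if for every root `α` it contains the root
subspace of `α` or that of `-α`; its Levi factor containing `H` is the sum of `H` and of the root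
subspaces of those `α` for which it contains both. -/
def IsLeviSubalgebra (𝔩 : LieSubalgebra ℂ L) : Prop :=
  ∃ 𝔭 : LieSubalgebra ℂ L, H ≤ 𝔭 ∧
    (∀ α ∈ rootSet H, rootSub H α ≤ 𝔭.toSubmodule ∨ rootSub H (-α) ≤ 𝔭.toSubmodule) ∧
    𝔩.toSubmodule = H.toSubmodule ⊔
      ⨆ α ∈ {α ∈ rootSet H | rootSub H α ≤ 𝔭.toSubmodule ∧ rootSub H (-α) ≤ 𝔭.toSubmodule},
        rootSub H α

/-- The set `Ω_𝔩` of roots of `𝔩`. -/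
def leviRoots (𝔩 : LieSubalgebra ℂ L) : Set (Module.Dual ℂ H) :=
  {α ∈ rootSet H | rootSub H α ≤ 𝔩.toSubmodule}

/-- The quotient of `H*` by the linear span of the roots of `𝔩`. -/
abbrev QuasirootSpace (𝔩 : LieSubalgebra ℂ L) : Type _ :=
  Module.Dual ℂ H ⧸ Submodule.span ℂ (leviRoots H 𝔩)

/-- The set of quasiroots: the image of `Ω` in the quotient space, without zero. -/
def quasiroots (𝔩 : LieSubalgebra ℂ L) : Set (QuasirootSpace H 𝔩) :=
  (Submodule.span ℂ (leviRoots H 𝔩)).mkQ '' rootSet H \ {0}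

/-- A semilinear subset `B` of a subset `Q = -Q` of a linear space. -/
def IsSemilinear {V : Type*} [AddCommGroup V] (Q B : Set V) : Prop :=
  (∀ x ∈ B, ∀ y ∈ B, x + y ∈ Q → x + y ∈ B) ∧ B ∩ -B = ∅ ∧ B ∪ -B = Q

/-- A system of positive quasiroots is a semilinear subset of the set of quasiroots. -/
def IsPositiveSystem (𝔩 : LieSubalgebra ℂ L) (Y : Set (QuasirootSpace H 𝔩)) : Prop :=
  IsSemilinear (quasiroots H 𝔩) Y

/-- The subspace `𝔪_β` for a quasiroot `β`: the sum of the root subspaces of the roots that are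
mapped to `β`. -/
def quasirootSub (𝔩 : LieSubalgebra ℂ L) (β : QuasirootSpace H 𝔩) : Submodule ℂ L :=
  ⨆ α ∈ {α ∈ rootSet H | (Submodule.span ℂ (leviRoots H 𝔩)).mkQ α = β}, rootSub H α

/-- The subspace `𝔪⁺`, the sum of the subspaces `𝔪_β` for the positive quasiroots `β`. -/
def mPlus (𝔩 : LieSubalgebra ℂ L) (Y : Set (QuasirootSpace H 𝔩)) : Submodule ℂ L :=
  ⨆ β ∈ Y, quasirootSub H 𝔩 β

end Roots

/-! ### Homogeneous spaces and polarizations -/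

section Polarization

variable {M : Type*} (G : Type*) [TopologicalSpace G] [Group G] [TopologicalSpace M] [MulAction G M]

/-- `M` is the homogeneous manifold `G/L`, where `L` is the stabilizer of `o`: the orbit map
`π : G → M`, `π(g) = g o`, is a surjective submersion. -/
def IsHomogeneousManifold (E F : Type*) [NormedAddCommGroup E] [NormedSpace ℂ E]
    [NormedAddCommGroup F] [NormedSpace ℂ F] [ChartedSpace E G] [ChartedSpace F M]
    (o : M) : Prop :=
  Function.Surjective (fun g : G ↦ g • o) ∧
    ∀ g : G, Function.Surjective (mfderiv 𝓘(ℂ, E) 𝓘(ℂ, F) (fun k : G ↦ k • o) g)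

/-- The Lie algebra of the stabilizer of `o`, as a subspace of the Lie algebra of `G`: the kernel
of `π_* : 𝔤 → T_o M`, that is, the set of all `X` whose vector field on `M` vanishes at `o`. -/
def isotropySub (E F : Type*) [NormedAddCommGroup E] [NormedSpace ℂ E]
    [NormedAddCommGroup F] [NormedSpace ℂ F] [ChartedSpace E G] [ChartedSpace F M]
    (o : M) : Submodule ℂ (GroupLieAlgebra 𝓘(ℂ, E) G) :=
  (mfderiv 𝓘(ℂ, E) 𝓘(ℂ, F) (fun k : G ↦ k • o) 1).ker

variable {G}

/-- The image in the tangent bundle of `M = G/L` of the left translates of a subspace `𝔫` of the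
Lie algebra of `G`, under the differential of the orbit map of `o`. If `𝔫` is `Ad L`-invariant and
meets the Lie algebra of `L` trivially, this is the subbundle of `T(M)` associated with `𝔫`. -/
def polarization {E : Type*} [NormedAddCommGroup E] [NormedSpace ℂ E] [ChartedSpace E G]
    (F : Type*) [NormedAddCommGroup F] [NormedSpace ℂ F] [ChartedSpace F M]
    (o : M) (𝔫 : Submodule ℂ (GroupLieAlgebra 𝓘(ℂ, E) G)) : Set (TangentBundle 𝓘(ℂ, F) M) :=
  {v | ∃ (g : G) (X : GroupLieAlgebra 𝓘(ℂ, E) G), X ∈ 𝔫 ∧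
    v = tangentMap 𝓘(ℂ, E) 𝓘(ℂ, F) (fun k : G ↦ k • o) ⟨g, mulInvariantVectorField X g⟩}

/-- The sections over `U` of the sheaf of holomorphic functions constant along a set `T` of
tangent vectors of `M`: those `a` whose derivative along every `v ∈ T` over `U` is zero. -/
def constantAlong {F : Type*} [NormedAddCommGroup F] [NormedSpace ℂ F] [ChartedSpace F M]
    (T : Set (TangentBundle 𝓘(ℂ, F) M)) (U : Opens M) : Set (HolFun F U) :=
  {a | ∀ v ∈ T, v.proj ∈ U → dirDeriv a.ext v.proj v.snd = 0}

end Polarization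

end

/-!
The value of `ν(a, b)` at a point `y = g • o` depends only on the jets of `a` and `b` at `y`, and
every such jet is detected by the values at `y` of the functions obtained from `a` or `b` by
repeatedly applying elements of the Lie algebra `𝔤`, because the vector fields coming from `𝔤` span
the tangent space at `y` (`iteratedFDeriv_eq_zero_of_wordAct`). So `ν` yields at `y` a bilinear form
on functions that is invariant under the isotropy algebra `Ad(g) 𝔩` of `y`.

The point is that the form is invariant under a well chosen semisimple element. The roots lying over
`Ω̄⁺`, together with the roots of `𝔩`, form a parabolic set of roots, and the sum `h` of the coroots
of the roots lying over `Ω̄⁺` vanishes on the roots of `𝔩` and is positive on the roots over `Ω̄⁺`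
(`RootPairing.nilCoroot_eq_zero`, `RootPairing.nilCoroot_pos`); here one needs that a root with image
`0` is a root of `𝔩`, which holds for Levi subalgebras (`rootSub_le_of_mem_span`). It is a grading element: it lies in
`𝔩`, its adjoint action is diagonalizable with integer eigenvalues, and the nonnegative part of this
grading is contained in `𝔩 + 𝔪⁺` (`exists_gradingElement`). At `y` one uses its translate `Ad(g) h`.

The functions constant along the polarization are stable under `𝔤`, since the polarization is
invariant under `G` (`lieAct_mem_constantAlong`). At `y` such a function is annihilated by
`Ad(g)(𝔩 + 𝔪⁺)` (`lieActFun_adLin_eq_zero`). Hence its derivative at `y` along a word of homogeneous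
elements vanishes if the last one applied has nonnegative degree, and commuting factors of
nonnegative degree to that end shows that the jet at `y` of such a function lies in the constants
plus a part on which all weights of `h` have the same strict sign. An invariant form pairs only
opposite weights, so it is determined by its values with one argument constant, and these are zero
(`bilin_eq_zero_of_grading`). This proves the first part (`BidiffOp.op_eq_zero_of_grading`).
The second follows by applying the first to every coefficient `μ_k` with `k > 0`.
-/

noncomputable section

/-! ### Parabolic sets of roots -/

namespace RootPairing

variable {ι R M N : Type*} [CommRing R] [AddCommGroup M] [Module R M] [AddCommGroup N] [Module R N]
  (P : RootPairing ι R M N)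

/-- A set of roots (given by indices) is parabolic if it is closed under addition and contains
`α` or `-α` for every root `α`; the index of `-α`, for `α` of index `i`, is
`P.reflectionPerm i i`. -/
def IsParabolicSet (S : Set ι) : Prop :=
  (∀ i ∈ S, ∀ j ∈ S, ∀ k, P.root k = P.root i + P.root j → k ∈ S) ∧
    ∀ i, i ∈ S ∨ P.reflectionPerm i i ∈ S

/-- The roots `α` of a parabolic set for which `-α` does not belong to the set: the roots of the
nilradical of the corresponding parabolic subalgebra. -/
def nilSet (S : Set ι) : Set ι :=
  {i ∈ S | P.reflectionPerm i i ∉ S}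

/-- The sum of the coroots of the roots in the nilradical of a parabolic set. -/
def nilCoroot [Finite ι] (S : Set ι) : N :=
  ∑ j ∈ (Set.toFinite (P.nilSet S)).toFinset, P.coroot j

theorem root_neg_idx (i : ι) : P.root (P.reflectionPerm i i) = -P.root i := by
  rw [root_reflectionPerm, reflection_apply_self]

variable {P} {S : Set ι}

theorem IsParabolicSet.nilSet_add (hS : P.IsParabolicSet S) {i j k : ι} (hi : i ∈ S)
    (hj : j ∈ P.nilSet S) (hk : P.root k = P.root j + P.root i) : k ∈ P.nilSet S := by
  refine ⟨hS.1 j hj.1 i hi k hk, fun h ↦ hj.2 (hS.1 _ h i hi _ ?_)⟩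
  rw [root_neg_idx, root_neg_idx, hk]
  abel

variable [Finite ι] [P.IsCrystallographic]

theorem root_nilCoroot (i : ι) : P.toLinearMap (P.root i) (P.nilCoroot S) =
    ((∑ j ∈ (Set.toFinite (P.nilSet S)).toFinset, P.pairingIn ℤ i j : ℤ) : R) := by
  rw [nilCoroot, map_sum, Int.cast_sum]
  refine Finset.sum_congr rfl fun j _ ↦ ?_
  exact (P.algebraMap_pairingIn ℤ i j).symm

variable [CharZero R] [IsDomain R] [P.IsReduced]

/-- The nilradical is closed under those reflections in roots `α` of the parabolic set which add a
nonnegative multiple of `α`, because it contains the whole `α`-string leading from a root to its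
reflection. -/
theorem IsParabolicSet.reflectionPerm_mem_nilSet (hS : P.IsParabolicSet S) {i j : ι} (hi : i ∈ S)
    (hj : j ∈ P.nilSet S) (hij : P.pairingIn ℤ j i ≤ 0) : P.reflectionPerm i j ∈ P.nilSet S := by
  obtain ⟨k, hk⟩ : ∃ k : ℕ, P.pairingIn ℤ j i = -k := ⟨(-P.pairingIn ℤ j i).toNat, by lia⟩
  have hroot : P.root (P.reflectionPerm i j) = P.root j + k • P.root i := by
    have h1 : P.pairing j i = -(k : R) := by
      rw [← P.algebraMap_pairingIn ℤ, hk]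
      simp
    rw [root_reflectionPerm, reflection_apply_root, h1, neg_smul, sub_neg_eq_add,
      Nat.cast_smul_eq_nsmul]
  by_cases hli : LinearIndependent R ![P.root i, P.root j]
  · have hkc : k ≤ P.chainTopCoeff i j :=
      (P.root_add_nsmul_mem_range_iff_le_chainTopCoeff hli).1 ⟨_, hroot⟩
    have key : ∀ n ≤ k, ∀ m, P.root m = P.root j + n • P.root i → m ∈ P.nilSet S := by
      intro n
      induction n with
      | zero =>
        intro _ m hm
        rw [zero_smul, add_zero] at hm
        rwa [P.root.injective hm]
      | succ n ih =>
        intro hn m hm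
        obtain ⟨m', hm'⟩ := (P.root_add_nsmul_mem_range_iff_le_chainTopCoeff hli).2
          (show n ≤ P.chainTopCoeff i j by lia)
        refine hS.nilSet_add hi (ih (by lia) m' hm') ?_
        rw [hm, hm', succ_nsmul, add_assoc]
    exact key k le_rfl _ hroot
  · exfalso
    rcases IsReduced.eq_or_eq_neg (P := P) i j hli with h | h
    · rw [P.root.injective h] at hij
      simp at hij
    · apply hj.2
      rwa [show P.reflectionPerm j j = i from P.root.injective (by rw [root_neg_idx, h])]

/-- A root `α` such that both `α` and `-α` belong to the parabolic set vanishes on the sum of the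
coroots of the nilradical, because the reflection in `α` permutes the nilradical. -/
theorem IsParabolicSet.nilCoroot_eq_zero (hS : P.IsParabolicSet S) {i : ι} (hi : i ∈ S)
    (hi' : P.reflectionPerm i i ∈ S) : P.toLinearMap (P.root i) (P.nilCoroot S) = 0 := by
  have hneg : ∀ j, P.reflectionPerm (P.reflectionPerm i i) j = P.reflectionPerm i j := fun j ↦ by
    apply P.root.injective
    rw [root_reflectionPerm, root_reflectionPerm, reflection_apply_root, reflection_apply_root,
      root_neg_idx, pairing_reflectionPerm_self_right]
    simp
  have hmem : ∀ j ∈ P.nilSet S, P.reflectionPerm i j ∈ P.nilSet S := by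
    intro j hj
    rcases le_total (P.pairingIn ℤ j i) 0 with h | h
    · exact hS.reflectionPerm_mem_nilSet hi hj h
    · rw [← hneg]
      refine hS.reflectionPerm_mem_nilSet hi' hj ?_
      have : P.pairingIn ℤ j (P.reflectionPerm i i) = -P.pairingIn ℤ j i := by
        rw [pairingIn_reflectionPerm_self_right]
      lia
  rw [root_nilCoroot]
  have h2 : ∑ j ∈ (Set.toFinite (P.nilSet S)).toFinset, P.pairingIn ℤ i j =
      ∑ j ∈ (Set.toFinite (P.nilSet S)).toFinset, -P.pairingIn ℤ i j := by
    refine Finset.sum_bij' (fun j _ ↦ P.reflectionPerm i j) (fun j _ ↦ P.reflectionPerm i j)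
      ?_ ?_ ?_ ?_ ?_
    · simpa using hmem
    · simpa using hmem
    · simp
    · simp
    · intro j _
      rw [pairingIn_reflectionPerm, pairingIn_reflectionPerm_self_left, neg_neg]
  rw [Finset.sum_neg_distrib] at h2
  rw [show (∑ j ∈ (Set.toFinite (P.nilSet S)).toFinset, P.pairingIn ℤ i j) = 0 by lia,
    Int.cast_zero]

/-- The reflection in a root `α` of the nilradical pairs off the coroots whose value at `α` is
negative with coroots of the nilradical whose value at `α` is positive; `α` itself is left over. -/
theorem IsParabolicSet.nilCoroot_pos (hS : P.IsParabolicSet S) {i : ι} (hi : i ∈ P.nilSet S) :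
    ∃ n : ℤ, 0 < n ∧ P.toLinearMap (P.root i) (P.nilCoroot S) = n := by
  classical
  refine ⟨_, ?_, root_nilCoroot i⟩
  set T := (Set.toFinite (P.nilSet S)).toFinset with hT
  rw [← Finset.sum_filter_add_sum_filter_not T (fun j ↦ P.reflectionPerm i j ∈ T)]
  have h1 : ∑ j ∈ T with P.reflectionPerm i j ∈ T, P.pairingIn ℤ i j =
      ∑ j ∈ T with P.reflectionPerm i j ∈ T, -P.pairingIn ℤ i j := by
    refine Finset.sum_bij' (fun j _ ↦ P.reflectionPerm i j) (fun j _ ↦ P.reflectionPerm i j)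
      ?_ ?_ ?_ ?_ ?_
    · intro j hj
      rw [Finset.mem_filter] at hj ⊢
      simpa using hj.symm
    · intro j hj
      rw [Finset.mem_filter] at hj ⊢
      simpa using hj.symm
    · simp
    · simp
    · intro j _
      rw [pairingIn_reflectionPerm, pairingIn_reflectionPerm_self_left, neg_neg]
  rw [Finset.sum_neg_distrib] at h1
  rw [show ∑ j ∈ T with P.reflectionPerm i j ∈ T, P.pairingIn ℤ i j = 0 by lia, zero_add]
  refine Finset.sum_pos' ?_ ⟨i, ?_, by simp⟩
  · intro j hj
    rw [Finset.mem_filter] at hj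
    by_contra! h
    refine hj.2 ?_
    rw [hT, Set.Finite.mem_toFinset] at hj ⊢
    refine hS.reflectionPerm_mem_nilSet hi.1 hj.1 ?_
    exact ((P.pairingIn_lt_zero_iff ℤ).1 h).le
  · rw [Finset.mem_filter, hT, Set.Finite.mem_toFinset, Set.Finite.mem_toFinset]
    exact ⟨hi, fun h ↦ hi.2 h.1⟩

end RootPairing

/-! ### The grading element of a system of positive quasiroots -/

section GradingElement

open LieAlgebra LieAlgebra.IsKilling LieModule

variable {L : Type*} [LieRing L] [LieAlgebra ℂ L] [FiniteDimensional ℂ L] [IsKilling ℂ L]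
  (H : LieSubalgebra ℂ L) [H.IsCartanSubalgebra]

variable {H} in
theorem mem_rootSet_iff {α : Module.Dual ℂ H} :
    α ∈ _root_.rootSet H ↔ ∃ i : H.root, (rootSystem H).root i = α := by
  constructor
  · rintro ⟨h0, h1⟩
    let w : Weight ℂ H L := ⟨α, fun h ↦ h1 ((LieSubmodule.toSubmodule_eq_bot _).2 h)⟩
    have hw : w.IsNonZero := fun h ↦ h0 (by ext x; exact congrFun h x)
    exact ⟨⟨w, by simpa using hw⟩, by ext x; rfl⟩
  · rintro ⟨i, rfl⟩
    refine ⟨(rootSystem H).ne_zero i, fun h ↦ Weight.genWeightSpace_ne_bot L i.1 ?_⟩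
    exact (LieSubmodule.toSubmodule_eq_bot _).1 h

/-- If `α`, `β` and `α + β` are roots then `[L_α, L_β] = L_{α + β}`; so a subalgebra containing the
first two root spaces contains the third one. -/
theorem rootSub_add_le (𝔭 : LieSubalgebra ℂ L) {i j k : H.root}
    (hk : (rootSystem H).root k = (rootSystem H).root i + (rootSystem H).root j)
    (hi : rootSub H ((rootSystem H).root i) ≤ 𝔭.toSubmodule)
    (hj : rootSub H ((rootSystem H).root j) ≤ 𝔭.toSubmodule) :
    rootSub H ((rootSystem H).root k) ≤ 𝔭.toSubmodule := by
  obtain ⟨α, hα'⟩ := i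
  obtain ⟨β, hβ'⟩ := j
  obtain ⟨γ, hγ'⟩ := k
  have hα : α.IsNonZero := by simpa using hα'
  have hγ : γ.IsNonZero := by simpa using hγ'
  have hadd : (γ : H → ℂ) = α + β := by
    ext x
    exact LinearMap.congr_fun hk x
  -- start from the end of the `α`-string through `β` in the direction of `-α`, and raise by `L_α`
  obtain ⟨z, hz, hz0⟩ := (chainTop (-α) β).exists_ne_zero
  obtain ⟨h, e, f, t, he, hf⟩ := exists_isSl2Triple_of_weight_isNonZero hα.neg
  obtain rfl := t.h_eq_coroot hα.neg he hf
  have prim : t.HasPrimitiveVectorWith z (chainLength (-α) β : ℂ) :=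
    have := lie_mem_genWeightSpace_of_mem_genWeightSpace he hz
    ⟨hz0, (chainLength_smul _ _ hz).symm, by rwa [genWeightSpace_add_chainTop _ _ hα.neg] at this⟩
  set n := chainTopCoeff (-α) β with hn
  have hlen : n + 1 ≤ chainLength (-α) β := by
    have h1 := (rootSpace_zsmul_add_ne_bot_iff (-α) β hα.neg (-1)).1 (by
      have : (-1 : ℤ) • ((-α : Weight ℂ H L) : H → ℂ) + β = γ := by
        rw [hadd]; simp
      rw [this]
      exact γ.genWeightSpace_ne_bot)
    have h2 := chainTopCoeff_add_chainBotCoeff (-α) β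
    lia
  have hfα : f ∈ rootSpace H α := by simpa using hf
  have hfp : f ∈ 𝔭 := hi hfα
  have hv : ((toEnd ℂ L L f) ^ n) z ∈ rootSpace H β := by
    have := toEnd_pow_apply_mem hfα hz n
    rwa [coe_chainTop, ← hn, Weight.coe_neg, smul_neg, Nat.cast_smul_eq_nsmul,
      add_neg_cancel_left] at this
  have hvp : ((toEnd ℂ L L f) ^ n) z ∈ 𝔭 := hj hv
  have hw0 := prim.pow_toEnd_f_ne_zero_of_eq_nat rfl hlen
  have hwe : ((toEnd ℂ L L f) ^ (n + 1)) z = ⁅f, ((toEnd ℂ L L f) ^ n) z⁆ := by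
    rw [pow_succ']; rfl
  have hw : ((toEnd ℂ L L f) ^ (n + 1)) z ∈ rootSpace H γ := by
    rw [hwe, hadd]
    exact lie_mem_genWeightSpace_of_mem_genWeightSpace hfα hv
  have hwp : ((toEnd ℂ L L f) ^ (n + 1)) z ∈ 𝔭 := by
    rw [hwe]
    exact 𝔭.lie_mem hfp hvp
  intro y hy
  obtain ⟨c, hc⟩ := (finrank_eq_one_iff_of_nonzero' (⟨_, hw⟩ : rootSpace H γ)
    (by simpa using hw0)).1 (finrank_rootSpace_eq_one γ hγ) ⟨y, hy⟩
  have hc' : c • ((toEnd ℂ L L f) ^ (n + 1)) z = y := congrArg Subtype.val hc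
  rw [← hc']
  exact 𝔭.smul_mem c hwp

/-- The roots of a parabolic subalgebra form a parabolic set. -/
theorem isParabolicSet_roots {𝔭 : LieSubalgebra ℂ L}
    (h𝔭 : ∀ α ∈ _root_.rootSet H, rootSub H α ≤ 𝔭.toSubmodule ∨ rootSub H (-α) ≤ 𝔭.toSubmodule) :
    (rootSystem H).IsParabolicSet {i | rootSub H ((rootSystem H).root i) ≤ 𝔭.toSubmodule} := by
  refine ⟨fun i hi j hj k hk ↦ rootSub_add_le H 𝔭 hk hi hj, fun i ↦ ?_⟩
  have := h𝔭 _ (mem_rootSet_iff.2 ⟨i, rfl⟩)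
  rwa [← (rootSystem H).root_neg_idx i] at this

/-- A root in the linear span of the roots of a Levi subalgebra is one of these roots: the roots of
the Levi subalgebra are the roots that vanish on the sum of the coroots of the nilradical of the
parabolic subalgebra. -/
theorem rootSub_le_of_mem_span {𝔩 : LieSubalgebra ℂ L} (hLevi : IsLeviSubalgebra H 𝔩)
    {α : Module.Dual ℂ H} (hα : α ∈ _root_.rootSet H)
    (hspan : α ∈ Submodule.span ℂ (leviRoots H 𝔩)) : rootSub H α ≤ 𝔩.toSubmodule := by
  obtain ⟨𝔭, hH, h𝔭, h𝔩⟩ := hLevi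
  have hP := isParabolicSet_roots H h𝔭
  set S : Set H.root := {i | rootSub H ((rootSystem H).root i) ≤ 𝔭.toSubmodule} with hS
  set h := (rootSystem H).nilCoroot S with hh
  have hcomm : ∀ x ∈ 𝔩, ⁅(h : L), x⁆ = 0 := by
    have : 𝔩.toSubmodule ≤ LinearMap.ker (toEnd ℂ L L (h : L)) := by
      rw [h𝔩]
      refine sup_le ?_ (iSup₂_le ?_)
      · intro x hx
        have h1 : ⁅h, (⟨x, hx⟩ : H)⁆ = 0 := trivial_lie_zero _ _ _ _
        exact congrArg Subtype.val h1
      · rintro β ⟨hβ, hβ1, hβ2⟩ x hx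
        obtain ⟨i, rfl⟩ := mem_rootSet_iff.1 hβ
        rw [← RootPairing.root_neg_idx] at hβ2
        have h1 : (rootSystem H).root i h = 0 := hP.nilCoroot_eq_zero hβ1 hβ2
        have h2 := lie_eq_smul_of_mem_rootSpace hx h
        rw [h1, zero_smul] at h2
        exact h2
    exact fun x hx ↦ this hx
  have hvan : ∀ β ∈ Submodule.span ℂ (leviRoots H 𝔩), β h = 0 := by
    have : Submodule.span ℂ (leviRoots H 𝔩) ≤ LinearMap.ker (Module.Dual.eval ℂ H h) := by
      refine Submodule.span_le.2 ?_
      rintro β ⟨⟨-, hβ0⟩, hβ⟩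
      obtain ⟨x, hx, hx0⟩ := (Submodule.ne_bot_iff _).1 hβ0
      have h2 : ⁅(h : L), x⁆ = β h • x := lie_eq_smul_of_mem_rootSpace hx h
      rw [hcomm x (hβ hx)] at h2
      exact (smul_eq_zero.1 h2.symm).resolve_right hx0
    exact fun β hβ ↦ this hβ
  obtain ⟨i, rfl⟩ := mem_rootSet_iff.1 hα
  have h0 := hvan _ hspan
  have hpos : ∀ j, j ∈ S → (rootSystem H).root j h = 0 → (rootSystem H).reflectionPerm j j ∈ S := by
    intro j hj hj0
    by_contra hj'
    obtain ⟨n, hn, hn'⟩ := hP.nilCoroot_pos ⟨hj, hj'⟩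
    rw [show (rootSystem H).toLinearMap ((rootSystem H).root j) _ =
      (rootSystem H).root j h from rfl, hj0] at hn'
    exact hn.ne (by exact_mod_cast hn')
  have hboth : i ∈ S ∧ (rootSystem H).reflectionPerm i i ∈ S := by
    rcases hP.2 i with hi | hi
    · exact ⟨hi, hpos i hi h0⟩
    · have := hpos _ hi (by rw [RootPairing.root_neg_idx, LinearMap.neg_apply, h0, neg_zero])
      refine ⟨?_, hi⟩
      convert this
      apply (rootSystem H).root.injective
      rw [RootPairing.root_neg_idx, RootPairing.root_neg_idx, neg_neg]
  rw [h𝔩]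
  refine le_sup_of_le_right (le_iSup₂_of_le _ ⟨hα, hboth.1, ?_⟩ le_rfl)
  rw [← RootPairing.root_neg_idx]
  exact hboth.2

/-- The roots mapped to positive quasiroots or to zero form a parabolic set. -/
theorem isParabolicSet_quasiroots {𝔩 : LieSubalgebra ℂ L} {Y : Set (QuasirootSpace H 𝔩)}
    (hY : IsPositiveSystem H 𝔩 Y) :
    (rootSystem H).IsParabolicSet {i | (Submodule.span ℂ (leviRoots H 𝔩)).mkQ
      ((rootSystem H).root i) ∈ insert 0 Y} := by
  obtain ⟨hadd, hdisj, hun⟩ := hY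
  have hq : ∀ i, (Submodule.span ℂ (leviRoots H 𝔩)).mkQ ((rootSystem H).root i) ≠ 0 →
      (Submodule.span ℂ (leviRoots H 𝔩)).mkQ ((rootSystem H).root i) ∈ quasiroots H 𝔩 :=
    fun i hi ↦ ⟨⟨_, mem_rootSet_iff.2 ⟨i, rfl⟩, rfl⟩, hi⟩
  constructor
  · intro i hi j hj k hk
    simp only [Set.mem_ofPred_eq] at hi hj ⊢
    by_cases h0 : (Submodule.span ℂ (leviRoots H 𝔩)).mkQ ((rootSystem H).root k) = 0
    · exact Or.inl h0
    have hk' := hq k h0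
    rw [hk, map_add] at hk' ⊢
    rcases hi with hi | hi
    · rw [hi, zero_add]; exact hj
    rcases hj with hj | hj
    · rw [hj, add_zero]; exact Or.inr hi
    exact Or.inr (hadd _ hi _ hj hk')
  · intro i
    simp only [Set.mem_ofPred_eq, RootPairing.root_neg_idx, map_neg]
    by_cases h0 : (Submodule.span ℂ (leviRoots H 𝔩)).mkQ ((rootSystem H).root i) = 0
    · exact Or.inl (Or.inl h0)
    have := hq i h0
    rw [← hun] at this
    exact this.imp Or.inr fun h ↦ Or.inr h

/-- A system of positive quasiroots gives rise to a grading element: an element of the Levi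
subalgebra whose adjoint action is diagonalizable with integer eigenvalues, the eigenvectors with
nonnegative eigenvalues lying in `𝔩 + 𝔪⁺`. It is the sum of the coroots of all roots mapped to
positive quasiroots. -/
theorem exists_gradingElement {𝔩 : LieSubalgebra ℂ L} (hLevi : IsLeviSubalgebra H 𝔩)
    {Y : Set (QuasirootSpace H 𝔩)} (hY : IsPositiveSystem H 𝔩 Y) :
    ∃ h ∈ 𝔩, (⨆ d : ℤ, (toEnd ℂ L L h).eigenspace (d : ℂ) = ⊤) ∧
      ∀ d : ℤ, 0 ≤ d → (toEnd ℂ L L h).eigenspace (d : ℂ) ≤ 𝔩.toSubmodule ⊔ mPlus H 𝔩 Y := by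
  have hP := isParabolicSet_quasiroots H hY
  set S : Set H.root := {i | (Submodule.span ℂ (leviRoots H 𝔩)).mkQ
      ((rootSystem H).root i) ∈ insert 0 Y} with hS
  set h := (rootSystem H).nilCoroot S with hh
  have hH𝔩 : H.toSubmodule ≤ 𝔩.toSubmodule := by
    obtain ⟨𝔭, -, -, h𝔩⟩ := hLevi
    rw [h𝔩]
    exact le_sup_left
  set A : ℤ → Submodule ℂ L := fun d ↦ (toEnd ℂ L L (h : L)).eigenspace (d : ℂ) with hA
  -- every root vector is an eigenvector, and lies in `𝔩 + 𝔪⁺` unless its eigenvalue is negative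
  have hroot : ∀ i : H.root, ∃ d : ℤ, rootSub H ((rootSystem H).root i) ≤ A d ∧
      (rootSub H ((rootSystem H).root i) ≤ 𝔩.toSubmodule ⊔ mPlus H 𝔩 Y ∨ d < 0) := by
    intro i
    have hle : ∀ d : ℤ, (rootSystem H).root i h = d →
        rootSub H ((rootSystem H).root i) ≤ A d := by
      intro d hd x hx
      rw [hA, Module.End.mem_eigenspace_iff, ← hd]
      exact lie_eq_smul_of_mem_rootSpace hx h
    have hmem : i ∈ S → rootSub H ((rootSystem H).root i) ≤ 𝔩.toSubmodule ⊔ mPlus H 𝔩 Y := by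
      rintro (hi | hi)
      · refine le_sup_of_le_left
          (rootSub_le_of_mem_span H hLevi (mem_rootSet_iff.2 ⟨i, rfl⟩) ?_)
        exact (Submodule.Quotient.mk_eq_zero _).1 hi
      · exact le_sup_of_le_right (le_iSup₂_of_le _ hi
          (le_iSup₂_of_le _ ⟨mem_rootSet_iff.2 ⟨i, rfl⟩, rfl⟩ le_rfl))
    by_cases hi : i ∈ S
    · by_cases hi' : (rootSystem H).reflectionPerm i i ∈ S
      · exact ⟨0, hle 0 (by rw [Int.cast_zero]; exact hP.nilCoroot_eq_zero hi hi'),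
          Or.inl (hmem hi)⟩
      · obtain ⟨n, -, hn⟩ := hP.nilCoroot_pos ⟨hi, hi'⟩
        exact ⟨n, hle n hn, Or.inl (hmem hi)⟩
    · have hi' := (hP.2 i).resolve_left hi
      obtain ⟨n, hn0, hn⟩ := hP.nilCoroot_pos (i := (rootSystem H).reflectionPerm i i) ⟨hi', by
        convert hi
        apply (rootSystem H).root.injective
        rw [RootPairing.root_neg_idx, RootPairing.root_neg_idx, neg_neg]⟩
      refine ⟨-n, hle _ ?_, Or.inr (by lia)⟩
      rw [RootPairing.root_neg_idx, map_neg, LinearMap.neg_apply] at hn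
      rw [Int.cast_neg, ← hn, neg_neg]
      rfl
  have hHA : H.toSubmodule ≤ A 0 := by
    intro x hx
    rw [hA, Module.End.mem_eigenspace_iff, Int.cast_zero, zero_smul]
    have h1 : ⁅h, (⟨x, hx⟩ : H)⁆ = 0 := trivial_lie_zero _ _ _ _
    exact congrArg Subtype.val h1
  have htop : H.toSubmodule ⊔ ⨆ i : H.root, rootSub H ((rootSystem H).root i) = ⊤ := by
    have := congrArg LieSubmodule.toSubmodule (cartan_sup_iSup_rootSpace_eq_top (K := ℂ) H)
    rw [LieSubmodule.sup_toSubmodule, LieSubmodule.iSup_toSubmodule,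
      LieSubmodule.top_toSubmodule] at this
    rw [eq_top_iff, ← this]
    refine sup_le_sup le_rfl (iSup_le fun α ↦ ?_)
    rw [LieSubmodule.iSup_toSubmodule]
    exact iSup_le fun hα ↦ le_iSup_of_le (⟨α, by simpa using hα⟩ : H.root) le_rfl
  choose d hd hd' using hroot
  refine ⟨h, hH𝔩 h.2, ?_, ?_⟩
  · rw [eq_top_iff, ← htop]
    exact sup_le (le_iSup_of_le 0 hHA) (iSup_le fun i ↦ le_iSup_of_le (d i) (hd i))
  · intro e he x hx
    have hsplit : ((𝔩.toSubmodule ⊔ mPlus H 𝔩 Y) ⊓ A e) ⊔ ⨆ (j) (_ : j ≠ e), A j = ⊤ := by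
      rw [eq_top_iff, ← htop]
      refine sup_le ?_ (iSup_le fun i ↦ ?_)
      · by_cases h0 : 0 = e
        · subst h0
          exact le_sup_of_le_left (le_inf (le_sup_of_le_left hH𝔩) hHA)
        · exact le_sup_of_le_right (le_iSup₂_of_le 0 h0 hHA)
      · by_cases hi : d i = e
        · subst hi
          exact le_sup_of_le_left (le_inf ((hd' i).resolve_right he.not_gt) (hd i))
        · exact le_sup_of_le_right (le_iSup₂_of_le _ hi (hd i))
    have hind : iSupIndep A :=
      (Module.End.eigenspaces_iSupIndep (toEnd ℂ L L (h : L))).comp Int.cast_injective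
    obtain ⟨y, hy, z, hz, rfl⟩ := Submodule.mem_sup.1 (hsplit ▸ Submodule.mem_top (x := x))
    have hz0 : z = 0 := by
      refine (Submodule.disjoint_def.1 (hind e)) z ?_ hz
      simpa using (A e).sub_mem hx hy.2
    rw [hz0, add_zero]
    exact hy.1

end GradingElement

/-! ### Invariant forms on modules with a graded evaluation functional -/

section WeightArgument

open LieModule Polynomial

attribute [local instance] LieRing.ofAssociativeRing

variable {L V : Type*} [LieRing L] [LieAlgebra ℂ L] [AddCommGroup V] [Module ℂ V]
  (ρ : L →ₗ⁅ℂ⁆ Module.End ℂ V)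

/-- The operator `X₁ ⋯ X_n` on a representation, for a list of elements `X_i` of the Lie algebra. -/
def wordAct (l : List L) : Module.End ℂ V := (l.map ρ).prod

theorem wordAct_nil : wordAct ρ [] = 1 := rfl

theorem wordAct_cons (X : L) (l : List L) : wordAct ρ (X :: l) = ρ X * wordAct ρ l := by
  simp [wordAct]

theorem wordAct_append (l l' : List L) : wordAct ρ (l ++ l') = wordAct ρ l * wordAct ρ l' := by
  simp [wordAct]

theorem wordAct_swap (l l' : List L) (X Z : L) :
    wordAct ρ (l ++ X :: Z :: l') =
      wordAct ρ (l ++ Z :: X :: l') + wordAct ρ (l ++ ⁅X, Z⁆ :: l') := by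
  simp only [wordAct_append, wordAct_cons, LieHom.map_lie, LieRing.of_associative_ring_bracket]
  noncomm_ring

variable {ρ} in
theorem wordAct_mem {C : Submodule ℂ V} (hC : ∀ X, ∀ v ∈ C, ρ X v ∈ C) (l : List L) {v : V}
    (hv : v ∈ C) : wordAct ρ l v ∈ C := by
  induction l with
  | nil => exact hv
  | cons X l ih =>
    rw [wordAct_cons]
    exact hC X _ ih

/-- A list of eigenvectors of `ad h`, recorded together with their integer eigenvalues. -/
def IsHomogeneousWord (h : L) (l : List (L × ℤ)) : Prop :=
  ∀ p ∈ l, p.1 ∈ (toEnd ℂ L L h).eigenspace (p.2 : ℂ)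

variable {ρ} {h : L}

theorem lie_mem_eigenspace_add {X Z : L} {c d : ℤ}
    (hX : X ∈ (toEnd ℂ L L h).eigenspace (c : ℂ)) (hZ : Z ∈ (toEnd ℂ L L h).eigenspace (d : ℂ)) :
    ⁅X, Z⁆ ∈ (toEnd ℂ L L h).eigenspace ((c + d : ℤ) : ℂ) := by
  rw [Module.End.mem_eigenspace_iff, toEnd_apply_apply] at hX hZ ⊢
  rw [leibniz_lie, hX, hZ, smul_lie, lie_smul, Int.cast_add, add_smul]

/-- Homogeneous words of nonnegative total weight have no constant term on the vectors without
constant term: a letter of nonnegative weight can be moved to the front, at the expense of shorter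
words of the same weight. -/
theorem eval_wordAct_eq_zero {C : Submodule ℂ V} {𝔭 : Submodule ℂ L} {ε : V →ₗ[ℂ] ℂ}
    (hC : ∀ X, ∀ v ∈ C, ρ X v ∈ C) (hε : ∀ X ∈ 𝔭, ∀ v ∈ C, ε (ρ X v) = 0)
    (hpos : ∀ d : ℤ, 0 ≤ d → (toEnd ℂ L L h).eigenspace (d : ℂ) ≤ 𝔭) {v : V} (hv : v ∈ C)
    (hv0 : ε v = 0) (n : ℕ) (l : List (L × ℤ)) (hn : l.length = n) (hl : IsHomogeneousWord h l)
    (hsum : 0 ≤ (l.map Prod.snd).sum) : ε (wordAct ρ (l.map Prod.fst) v) = 0 := by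
  induction n generalizing l with
  | zero =>
    rw [List.length_eq_zero_iff.1 hn]
    exact hv0
  | succ n ih =>
    have key : ∀ (s t : List (L × ℤ)) (p : L × ℤ), 0 ≤ p.2 → (s ++ p :: t).length = n + 1 →
        IsHomogeneousWord h (s ++ p :: t) → 0 ≤ ((s ++ p :: t).map Prod.snd).sum →
        ε (wordAct ρ ((s ++ p :: t).map Prod.fst) v) = 0 := by
      intro s
      induction s using List.reverseRecOn with
      | nil =>
        intro t p hp _ hom _
        simp only [List.nil_append, List.map_cons, wordAct_cons]
        exact hε _ (hpos _ hp (hom p (by simp))) _ (wordAct_mem hC _ hv)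
      | append_singleton s q ihs =>
        intro t p hp hlen hom hsum
        have h1 := ihs (q :: t) p hp (by simp at hlen ⊢; lia)
          (fun r hr ↦ hom r (by simp at hr ⊢; tauto)) (by simp at hsum ⊢; lia)
        have h2 := ih (s ++ (⁅q.1, p.1⁆, q.2 + p.2) :: t) (by simp at hlen ⊢; lia) (by
          intro r hr
          rw [List.mem_append, List.mem_cons] at hr
          rcases hr with hr | rfl | hr
          · exact hom r (by simp [hr])
          · exact lie_mem_eigenspace_add (hom q (by simp)) (hom p (by simp))
          · exact hom r (by simp [hr])) (by simp at hsum ⊢; lia)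
        simp only [List.map_append, List.map_cons, List.append_assoc,
          List.cons_append, List.nil_append] at h1 h2 ⊢
        rw [wordAct_swap, LinearMap.add_apply, map_add, h1, h2, add_zero]
    obtain ⟨p, hp, hp0⟩ : ∃ p ∈ l, 0 ≤ p.2 := by
      by_contra! hneg
      have hne : l ≠ [] := by
        rintro rfl
        simp at hn
      have := List.sum_lt_sum_of_ne_nil hne Prod.snd (fun _ ↦ 0) hneg
      rw [List.map_const', List.sum_replicate, smul_zero] at this
      lia
    obtain ⟨s, t, rfl⟩ := List.append_of_mem hp
    exact key s t p hp0 hn hl hsum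

theorem comp_wordAct {l : List (L × ℤ)} (hl : IsHomogeneousWord h l) :
    ρ h * wordAct ρ (l.map Prod.fst) = wordAct ρ (l.map Prod.fst) * ρ h +
      (((l.map Prod.snd).sum : ℤ) : ℂ) • wordAct ρ (l.map Prod.fst) := by
  induction l with
  | nil => simp [wordAct_nil]
  | cons p l ih =>
    have h1 : ρ h * ρ p.1 = ρ p.1 * ρ h + (p.2 : ℂ) • ρ p.1 := by
      have := hl p (by simp)
      rw [Module.End.mem_eigenspace_iff, toEnd_apply_apply] at this
      rw [← map_smul, ← this, LieHom.map_lie, LieRing.of_associative_ring_bracket]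
      abel
    simp only [List.map_cons, wordAct_cons, List.sum_cons, Int.cast_add]
    rw [← mul_assoc, h1, add_mul, mul_assoc, ih fun q hq ↦ hl q (by simp [hq]), mul_add,
      smul_mul_assoc, mul_smul_comm, add_smul, mul_assoc]
    abel

theorem aeval_mem {C : Submodule ℂ V} {S : Module.End ℂ V} (hS : ∀ v ∈ C, S v ∈ C) (q : ℂ[X])
    {v : V} (hv : v ∈ C) : aeval S q v ∈ C := by
  induction q using Polynomial.induction_on' with
  | add p q hp hq => rw [map_add]; exact C.add_mem hp hq
  | monomial n a =>
    rw [aeval_monomial, Module.End.mul_apply, Module.algebraMap_end_apply]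
    refine C.smul_mem a ?_
    induction n with
    | zero => exact hv
    | succ n ih => rw [pow_succ']; exact hS _ ih

/-- If `ε` annihilates `h · C`, then evaluating along a word of total weight `s` turns `h` into
multiplication by `-s`. -/
theorem eval_wordAct_aeval {C : Submodule ℂ V} {𝔭 : Submodule ℂ L} {ε : V →ₗ[ℂ] ℂ}
    (hC : ∀ X, ∀ v ∈ C, ρ X v ∈ C) (hε : ∀ X ∈ 𝔭, ∀ v ∈ C, ε (ρ X v) = 0) (hh : h ∈ 𝔭)
    {l : List (L × ℤ)} (hl : IsHomogeneousWord h l) (q : ℂ[X]) {v : V} (hv : v ∈ C) :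
    ε (wordAct ρ (l.map Prod.fst) (aeval (ρ h) q v)) =
      q.eval (-((l.map Prod.snd).sum : ℤ) : ℂ) * ε (wordAct ρ (l.map Prod.fst) v) := by
  have step : ∀ w ∈ C, ε (wordAct ρ (l.map Prod.fst) (ρ h w)) =
      (-((l.map Prod.snd).sum : ℤ) : ℂ) * ε (wordAct ρ (l.map Prod.fst) w) := by
    intro w hw
    have h1 := congrArg ε (LinearMap.congr_fun (comp_wordAct (ρ := ρ) hl) w)
    rw [Module.End.mul_apply, hε h hh _ (wordAct_mem hC _ hw), LinearMap.add_apply, map_add,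
      LinearMap.smul_apply, map_smul, Module.End.mul_apply, smul_eq_mul] at h1
    linear_combination -h1
  induction q using Polynomial.induction_on' with
  | add p q hp hq => rw [map_add, LinearMap.add_apply, map_add, map_add, hp, hq, eval_add, add_mul]
  | monomial n a =>
    rw [aeval_monomial, Module.End.mul_apply, Module.algebraMap_end_apply, map_smul, map_smul,
      eval_monomial, smul_eq_mul, mul_assoc]
    congr 1
    induction n with
    | zero => simp
    | succ n ih =>
      have hm : ((ρ h) ^ n) v ∈ C := by
        have := aeval_mem (hC h) (X ^ n) hv
        rwa [map_pow, aeval_X] at this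
      rw [pow_succ', Module.End.mul_apply, step _ hm, ih, pow_succ', mul_assoc]

/-- If all homogeneous words of bounded length vanish on a vector at the evaluation functional, so
do all words of bounded length. -/
theorem eval_wordAct_of_homogeneous (htop : ⨆ d : ℤ, (toEnd ℂ L L h).eigenspace (d : ℂ) = ⊤)
    {ε : V →ₗ[ℂ] ℂ} {k : ℕ} {v : V}
    (hv : ∀ l : List (L × ℤ), l.length ≤ k → IsHomogeneousWord h l →
      ε (wordAct ρ (l.map Prod.fst) v) = 0) (l : List L) (hl : l.length ≤ k) :
    ε (wordAct ρ l v) = 0 := by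
  have key : ∀ (l : List L) (s : List (L × ℤ)), IsHomogeneousWord h s → s.length + l.length ≤ k →
      ε (wordAct ρ (s.map Prod.fst ++ l) v) = 0 := by
    intro l
    induction l with
    | nil =>
      intro s hs hk
      rw [List.append_nil]
      exact hv s (by simpa using hk) hs
    | cons X l ih =>
      intro s hs hk
      have hX : X ∈ ⨆ d : ℤ, (toEnd ℂ L L h).eigenspace (d : ℂ) := htop ▸ Submodule.mem_top
      induction hX using Submodule.iSup_induction' with
      | mem d X hX =>
        have := ih (s ++ [(X, d)]) (by
          intro p hp
          rw [List.mem_append, List.mem_singleton] at hp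
          rcases hp with hp | rfl
          · exact hs p hp
          · exact hX) (by simp at hk ⊢; lia)
        simpa using this
      | zero => simp [wordAct_append, wordAct_cons]
      | add X Z _ _ hX hZ =>
        rw [wordAct_append, wordAct_cons] at hX hZ ⊢
        rw [map_add, add_mul, mul_add, LinearMap.add_apply, map_add, hX hk, hZ hk, add_zero]
  exact key l [] (by simp [IsHomogeneousWord]) (by simpa using hl)

theorem exists_bound_eigenvalues [FiniteDimensional ℂ L] (h : L) :
    ∃ K : ℕ, ∀ d : ℤ, (toEnd ℂ L L h).eigenspace (d : ℂ) ≠ ⊥ → -d ≤ K := by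
  have hfin : {d : ℤ | (toEnd ℂ L L h).HasEigenvalue (d : ℂ)}.Finite :=
    (Module.End.finite_hasEigenvalue _).preimage Int.cast_injective.injOn
  obtain ⟨b, hb⟩ := hfin.bddBelow
  exact ⟨(-b).toNat, fun d hd ↦ by have := hb (show d ∈ _ from hd); lia⟩

theorem bilin_aeval {C : Submodule ℂ V} {S : Module.End ℂ V} (hS : ∀ v ∈ C, S v ∈ C)
    {B : V →ₗ[ℂ] V →ₗ[ℂ] ℂ} (hB : ∀ v ∈ C, ∀ w ∈ C, B (S v) w + B v (S w) = 0) (q : ℂ[X])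
    {v w : V} (hv : v ∈ C) (hw : w ∈ C) : B (aeval S q v) w = B v (aeval S (q.comp (-X)) w) := by
  induction q using Polynomial.induction_on' with
  | add p q hp hq =>
    rw [map_add, LinearMap.add_apply, map_add, LinearMap.add_apply, hp, hq, add_comp, map_add,
      LinearMap.add_apply, map_add]
  | monomial n a =>
    rw [aeval_monomial, Module.End.mul_apply, Module.algebraMap_end_apply, map_smul,
      LinearMap.smul_apply, monomial_comp, map_mul, aeval_C, Module.End.mul_apply,
      Module.algebraMap_end_apply, map_smul, map_pow, map_neg, aeval_X]
    congr 1
    induction n generalizing w with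
    | zero => simp
    | succ n ih =>
      have hm : (S ^ n) v ∈ C := by
        have := aeval_mem hS (X ^ n) hv
        rwa [map_pow, aeval_X] at this
      rw [pow_succ', Module.End.mul_apply, eq_neg_of_add_eq_zero_left (hB _ hm _ hw),
        ih (hS w hw), pow_succ, Module.End.mul_apply, LinearMap.neg_apply, map_neg, map_neg]

theorem isCoprime_prod_comp_neg (N : ℕ) :
    IsCoprime (∏ j ∈ Finset.Icc 1 N, (X - Polynomial.C (j : ℂ)))
      ((∏ j ∈ Finset.Icc 1 N, (X - Polynomial.C (j : ℂ))).comp (-X)) := by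
  rw [prod_comp]
  refine IsCoprime.prod_left fun i hi ↦ IsCoprime.prod_right fun j _ ↦ ?_
  have hij : (i : ℂ) + j ≠ 0 := by
    have := (Finset.mem_Icc.1 hi).1
    exact_mod_cast (show i + j ≠ 0 by lia)
  refine ⟨Polynomial.C (-(i + j : ℂ)⁻¹), Polynomial.C (-(i + j : ℂ)⁻¹), ?_⟩
  rw [sub_comp, X_comp, C_comp, ← mul_add,
    show X - Polynomial.C (i : ℂ) + (-X - Polynomial.C (j : ℂ)) = Polynomial.C (-(i + j : ℂ)) by
      simp only [map_neg, map_add]; ring, ← map_mul, neg_mul_neg, inv_mul_cancel₀ hij, map_one]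

/-- Let `C` be a submodule of a representation, `ε` an evaluation functional on it which vanishes
on `𝔭 · C`, where `𝔭` contains the nonnegative part of the grading of the Lie algebra given by `h`.
A bilinear form on `C` which is `h`-invariant, depends only on the jets of bounded order of its
arguments with respect to `ε`, and vanishes on constants, is zero: on the jets without constant term
the eigenvalues of `h` are positive, while an invariant form can pair nontrivially only opposite
eigenvalues. -/
theorem bilin_eq_zero_of_grading [FiniteDimensional ℂ L]
    {C : Submodule ℂ V} {𝔭 : Submodule ℂ L} {ε : V →ₗ[ℂ] ℂ}
    (hC : ∀ X, ∀ v ∈ C, ρ X v ∈ C) (hε : ∀ X ∈ 𝔭, ∀ v ∈ C, ε (ρ X v) = 0)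
    (htop : ⨆ d : ℤ, (toEnd ℂ L L h).eigenspace (d : ℂ) = ⊤)
    (hpos : ∀ d : ℤ, 0 ≤ d → (toEnd ℂ L L h).eigenspace (d : ℂ) ≤ 𝔭)
    {B : V →ₗ[ℂ] V →ₗ[ℂ] ℂ} (hinv : ∀ v ∈ C, ∀ w ∈ C, B (ρ h v) w + B v (ρ h w) = 0)
    {e : V} (heC : e ∈ C) (he : ε e = 1) (hBe : ∀ v ∈ C, B e v = 0 ∧ B v e = 0) (k : ℕ)
    (hjet : ∀ v ∈ C, (∀ l : List L, l.length ≤ k → ε (wordAct ρ l v) = 0) →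
      ∀ w ∈ C, B v w = 0 ∧ B w v = 0) {v w : V} (hv : v ∈ C) (hw : w ∈ C) : B v w = 0 := by
  have hh : h ∈ 𝔭 := hpos 0 le_rfl (by
    rw [Module.End.mem_eigenspace_iff, toEnd_apply_apply, lie_self, Int.cast_zero, zero_smul])
  obtain ⟨K, hK⟩ := exists_bound_eigenvalues h
  -- the eigenvalues of `h` on the jets of order at most `k` without constant term are roots of `p`
  set p : ℂ[X] := ∏ j ∈ Finset.Icc 1 (k * K), (X - Polynomial.C (j : ℂ)) with hp
  have hkill : ∀ v ∈ C, ε v = 0 →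
      ∀ l : List L, l.length ≤ k → ε (wordAct ρ l (aeval (ρ h) p v)) = 0 := by
    intro v hv hv0
    refine eval_wordAct_of_homogeneous htop fun l hlk hl ↦ ?_
    rw [eval_wordAct_aeval hC hε hh hl p hv]
    by_cases hs : 0 ≤ (l.map Prod.snd).sum
    · rw [eval_wordAct_eq_zero hC hε hpos hv hv0 _ l rfl hl hs, mul_zero]
    by_cases h0 : ∃ q ∈ l, q.1 = 0
    · obtain ⟨q, hq, hq0⟩ := h0
      obtain ⟨s, t, rfl⟩ := List.append_of_mem hq
      simp [wordAct_append, wordAct_cons, hq0]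
    push Not at h0
    have hbound : -(l.map Prod.snd).sum ≤ k * K := by
      have h1 : ∀ l : List (L × ℤ), IsHomogeneousWord h l → (∀ q ∈ l, q.1 ≠ 0) →
          -(l.map Prod.snd).sum ≤ l.length * K := by
        intro l
        induction l with
        | nil => simp
        | cons q l ih =>
          intro hl h0
          have h2 := ih (fun r hr ↦ hl r (by simp [hr])) (fun r hr ↦ h0 r (by simp [hr]))
          have h3 := hK q.2 ((Submodule.ne_bot_iff _).2 ⟨q.1, hl q (by simp), h0 q (by simp)⟩)
          simp only [List.map_cons, List.sum_cons, List.length_cons]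
          push_cast
          linarith
      refine (h1 l hl h0).trans ?_
      gcongr
    -- the total weight is the opposite of one of the roots of `p`
    obtain ⟨m, hm⟩ : ∃ m : ℕ, -(l.map Prod.snd).sum = m :=
      ⟨(-(l.map Prod.snd).sum).toNat, by lia⟩
    have hroot : p.eval (-((l.map Prod.snd).sum : ℤ) : ℂ) = 0 := by
      rw [hp, eval_prod]
      refine Finset.prod_eq_zero (i := m) (Finset.mem_Icc.2 ⟨by lia, ?_⟩) ?_
      · have : (m : ℤ) ≤ k * K := hm ▸ hbound
        exact_mod_cast this
      · rw [eval_sub, eval_X, eval_C, ← Int.cast_neg, hm, Int.cast_natCast, sub_self]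
    rw [hroot, zero_mul]
  have hS := hC h
  have hmain : ∀ v ∈ C, ε v = 0 → ∀ w ∈ C, ε w = 0 → B v w = 0 := by
    intro v hv hv0 w hw hw0
    have hzero : ∀ q : ℂ[X], ε (aeval (ρ h) q w) = 0 := by
      intro q
      have := eval_wordAct_aeval hC hε hh (l := []) (by simp [IsHomogeneousWord]) q hw
      simpa [wordAct_nil, hw0] using this
    -- `p(h)` can be moved from the first argument to the second as `p(-h)`, and the two polynomials
    -- are coprime, so that `w` is the sum of a vector in the range of `p(h)` and one in that of
    -- `p(-h)`; the form vanishes on each of the two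
    obtain ⟨a, b, hab⟩ := isCoprime_prod_comp_neg (k * K)
    rw [← hp] at hab
    have hw' : w = aeval (ρ h) p (aeval (ρ h) a w) +
        aeval (ρ h) (p.comp (-X)) (aeval (ρ h) b w) := by
      rw [← Module.End.mul_apply, ← Module.End.mul_apply, ← map_mul, ← map_mul,
        ← LinearMap.add_apply, ← map_add, mul_comm p, mul_comm (p.comp _), hab, map_one,
        Module.End.one_apply]
    rw [hw', map_add, ← bilin_aeval hS hinv p hv (aeval_mem hS b hw),
      (hjet _ (aeval_mem hS p (aeval_mem hS a hw)) (hkill _ (aeval_mem hS a hw) (hzero a)) v hv).2,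
      (hjet _ (aeval_mem hS p hv) (hkill v hv hv0) _ (aeval_mem hS b hw)).1, add_zero]
  have hsub : ∀ v ∈ C, v - ε v • e ∈ C ∧ ε (v - ε v • e) = 0 := fun v hv ↦
    ⟨C.sub_mem hv (C.smul_mem _ heC), by rw [map_sub, map_smul, he, smul_eq_mul, mul_one, sub_self]⟩
  have h1 := hmain _ (hsub v hv).1 (hsub v hv).2 _ (hsub w hw).1 (hsub w hw).2
  simpa [map_sub, (hBe v hv).2, (hBe w hw).1, (hBe e heC).1] using h1

end WeightArgument

/-! ### Mixed derivatives -/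

section MixedDerivatives

variable {E₁ E₂ : Type*} [NormedAddCommGroup E₁] [NormedSpace ℂ E₁]
  [NormedAddCommGroup E₂] [NormedSpace ℂ E₂]

theorem hasFDerivAt_fderiv_prodMk {f : E₁ × E₂ → ℂ} {p : E₁} {q : E₂} (hf : ContDiffAt ℂ ω f (p, q))
    (w : E₂) :
    HasFDerivAt (fun x ↦ fderiv ℂ (fun y ↦ f (x, y)) q w)
      (((fderiv ℂ (fderiv ℂ f) (p, q)).comp (ContinuousLinearMap.inl ℂ E₁ E₂)).flip (0, w)) p := by
  have hev : ∀ᶠ x in 𝓝 p, fderiv ℂ (fun y ↦ f (x, y)) q w = fderiv ℂ f (x, q) (0, w) := by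
    have h1 : ∀ᶠ z in 𝓝 (p, q), DifferentiableAt ℂ f z := by
      filter_upwards [hf.eventually (by simp)] with z hz using hz.differentiableAt (by simp)
    have h2 : Filter.Tendsto (fun x ↦ (x, q)) (𝓝 p) (𝓝 (p, q)) :=
      (Continuous.prodMk_left q).tendsto p
    filter_upwards [h2.eventually h1] with x hx
    have h3 := hx.hasFDerivAt.comp q (hasFDerivAt_prodMk_right (𝕜 := ℂ) x q)
    rw [show (fun y ↦ f (x, y)) = f ∘ fun y ↦ (x, y) from rfl, h3.fderiv]
    simp
  refine HasFDerivAt.congr_of_eventuallyEq ?_ hev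
  have h4 : DifferentiableAt ℂ (fderiv ℂ f) (p, q) :=
    (hf.fderiv_right (m := 1) le_top).differentiableAt one_ne_zero
  have h5 := h4.hasFDerivAt.comp p (hasFDerivAt_prodMk_left (𝕜 := ℂ) p q)
  have h6 := h5.clm_apply (hasFDerivAt_const ((0 : E₁), w) p)
  refine h6.congr_fderiv ?_
  ext v
  simp

theorem fderiv_fderiv_prodMk {f : E₁ × E₂ → ℂ} {p : E₁} {q : E₂} (hf : ContDiffAt ℂ ω f (p, q))
    (v : E₁) (w : E₂) :
    fderiv ℂ (fun x ↦ fderiv ℂ (fun y ↦ f (x, y)) q w) p v =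
      fderiv ℂ (fderiv ℂ f) (p, q) (v, 0) (0, w) := by
  rw [(hasFDerivAt_fderiv_prodMk hf w).fderiv]
  simp

theorem fderiv_fderiv_comm {f : E₁ × E₂ → ℂ} {p : E₁} {q : E₂} (hf : ContDiffAt ℂ ω f (p, q))
    (v : E₁) (w : E₂) :
    fderiv ℂ (fun x ↦ fderiv ℂ (fun y ↦ f (x, y)) q w) p v =
      fderiv ℂ (fun y ↦ fderiv ℂ (fun x ↦ f (x, y)) p v) q w := by
  have hswap : ContDiffAt ℂ ω (f ∘ Prod.swap) (q, p) :=
    ContDiffAt.comp (q, p) (f := Prod.swap) hf (contDiff_snd.prodMk contDiff_fst).contDiffAt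
  have hd : DifferentiableAt ℂ (fderiv ℂ f) (p, q) :=
    (hf.fderiv_right (m := 1) le_top).differentiableAt one_ne_zero
  have h2 := fderiv_fderiv_prodMk hswap w v
  have h3 : ∀ z, fderiv ℂ (f ∘ Prod.swap) z =
      (fderiv ℂ f z.swap).comp (ContinuousLinearEquiv.prodComm ℂ E₂ E₁ : E₂ × E₁ →L[ℂ] E₁ × E₂) :=
    fun z ↦ (ContinuousLinearEquiv.prodComm ℂ E₂ E₁).comp_right_fderiv
  have h4 : fderiv ℂ (fderiv ℂ (f ∘ Prod.swap)) (q, p) (w, 0) (0, v) =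
      fderiv ℂ (fderiv ℂ f) (p, q) (0, w) (v, 0) := by
    rw [show fderiv ℂ (f ∘ Prod.swap) = fun z ↦ (fderiv ℂ f z.swap).comp
      (ContinuousLinearEquiv.prodComm ℂ E₂ E₁ : E₂ × E₁ →L[ℂ] E₁ × E₂) from funext h3]
    have h5 : HasFDerivAt (fun z : E₂ × E₁ ↦ fderiv ℂ f z.swap)
        ((fderiv ℂ (fderiv ℂ f) (p, q)).comp
          (ContinuousLinearEquiv.prodComm ℂ E₂ E₁ : E₂ × E₁ →L[ℂ] E₁ × E₂)) (q, p) :=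
      HasFDerivAt.comp (q, p) (f := fun z : E₂ × E₁ ↦ z.swap) hd.hasFDerivAt
        (ContinuousLinearEquiv.prodComm ℂ E₂ E₁).hasFDerivAt
    rw [(h5.clm_comp (hasFDerivAt_const _ _)).fderiv]
    simp
  rw [fderiv_fderiv_prodMk hf]
  change _ = fderiv ℂ (fun x ↦ fderiv ℂ (fun y ↦ (f ∘ Prod.swap) (x, y)) p v) q w
  rw [h2, h4]
  exact (hf.isSymmSndFDerivAt (by simp)) _ _

variable {M N : Type*} [TopologicalSpace M] [ChartedSpace E₁ M]
  [TopologicalSpace N] [ChartedSpace E₂ N]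

theorem dirDeriv_eq_fderiv {f : M → ℂ} {p : M} (hf : MDifferentiableAt 𝓘(ℂ, E₁) 𝓘(ℂ) f p)
    (v : TangentSpace 𝓘(ℂ, E₁) p) :
    dirDeriv f p v =
      fderiv ℂ (f ∘ (extChartAt 𝓘(ℂ, E₁) p).symm) (extChartAt 𝓘(ℂ, E₁) p p) v := by
  rw [dirDeriv, hf.mfderiv, ModelWithCorners.range_eq_univ, fderivWithin_univ]
  rfl

theorem mdifferentiableAt_of_comp_symm [IsManifold 𝓘(ℂ, E₁) ω M] {f : M → ℂ} {p : M}
    (hf : DifferentiableAt ℂ (f ∘ (extChartAt 𝓘(ℂ, E₁) p).symm) (extChartAt 𝓘(ℂ, E₁) p p)) :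
    MDifferentiableAt 𝓘(ℂ, E₁) 𝓘(ℂ) f p := by
  have : IsManifold 𝓘(ℂ, E₁) 1 M := IsManifold.of_le (n := ω) le_top
  have h1 : MDifferentiableAt 𝓘(ℂ, E₁) 𝓘(ℂ, E₁) (extChartAt 𝓘(ℂ, E₁) p) p :=
    mdifferentiableAt_extChartAt (mem_chart_source _ p)
  refine (hf.mdifferentiableAt.comp p h1).congr_of_eventuallyEq ?_
  filter_upwards [extChartAt_source_mem_nhds (I := 𝓘(ℂ, E₁)) p] with x hx
  simp only [Function.comp]
  rw [(extChartAt 𝓘(ℂ, E₁) p).left_inv hx]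

/-- A mixed derivative of a function of two variables in manifolds, computed in charts. -/
theorem dirDeriv_dirDeriv_eq [IsManifold 𝓘(ℂ, E₁) ω M] [IsManifold 𝓘(ℂ, E₂) ω N]
    {f : M × N → ℂ} {p : M} {q : N}
    (hf : ContMDiffAt (𝓘(ℂ, E₁).prod 𝓘(ℂ, E₂)) 𝓘(ℂ) ω f (p, q))
    (v : TangentSpace 𝓘(ℂ, E₁) p) (w : TangentSpace 𝓘(ℂ, E₂) q) :
    ContDiffAt ℂ ω (fun z : E₁ × E₂ ↦
      f ((extChartAt 𝓘(ℂ, E₁) p).symm z.1, (extChartAt 𝓘(ℂ, E₂) q).symm z.2))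
      (extChartAt 𝓘(ℂ, E₁) p p, extChartAt 𝓘(ℂ, E₂) q q) ∧
    dirDeriv (fun x ↦ dirDeriv (fun y ↦ f (x, y)) q w) p v =
      fderiv ℂ (fun x ↦ fderiv ℂ (fun y ↦
        f ((extChartAt 𝓘(ℂ, E₁) p).symm x, (extChartAt 𝓘(ℂ, E₂) q).symm y))
        (extChartAt 𝓘(ℂ, E₂) q q) w) (extChartAt 𝓘(ℂ, E₁) p p) v := by
  have hF : ContDiffAt ℂ ω (fun z : E₁ × E₂ ↦
      f ((extChartAt 𝓘(ℂ, E₁) p).symm z.1, (extChartAt 𝓘(ℂ, E₂) q).symm z.2))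
      (extChartAt 𝓘(ℂ, E₁) p p, extChartAt 𝓘(ℂ, E₂) q q) := by
    have h1 := contMDiffAt_iff_source.1 hf
    rw [ModelWithCorners.range_eq_univ, contMDiffWithinAt_univ, extChartAt_prod] at h1
    exact h1.contDiffAt
  refine ⟨hF, ?_⟩
  have hev : (fun x ↦ dirDeriv (fun y ↦ f (x, y)) q w) =ᶠ[𝓝 p] fun x ↦
      fderiv ℂ (fun y ↦ f (x, (extChartAt 𝓘(ℂ, E₂) q).symm y)) (extChartAt 𝓘(ℂ, E₂) q q) w := by
    have h1 : ∀ᶠ z in 𝓝 (p, q), ContMDiffAt (𝓘(ℂ, E₁).prod 𝓘(ℂ, E₂)) 𝓘(ℂ) 1 f z :=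
      (contMDiffAt_iff_contMDiffAt_nhds (by simp)).1 (hf.of_le le_top)
    have h2 : Filter.Tendsto (fun x ↦ (x, q)) (𝓝 p) (𝓝 (p, q)) :=
      (Continuous.prodMk_left q).tendsto p
    filter_upwards [h2.eventually h1] with x hx
    have h3 : ContMDiffAt 𝓘(ℂ, E₂) (𝓘(ℂ, E₁).prod 𝓘(ℂ, E₂)) 1 (fun y : N ↦ (x, y)) q :=
      contMDiffAt_const.prodMk contMDiffAt_id
    exact dirDeriv_eq_fderiv ((hx.comp q h3).mdifferentiableAt one_ne_zero) w
  have hdiff := (hasFDerivAt_fderiv_prodMk hF w).differentiableAt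
  unfold dirDeriv at hev ⊢
  rw [hev.mfderiv_eq]
  exact dirDeriv_eq_fderiv (mdifferentiableAt_of_comp_symm hdiff) v

/-- Derivatives of an analytic function of two variables, each in a manifold, commute. -/
theorem dirDeriv_dirDeriv_comm [IsManifold 𝓘(ℂ, E₁) ω M] [IsManifold 𝓘(ℂ, E₂) ω N]
    {f : M × N → ℂ} {p : M} {q : N}
    (hf : ContMDiffAt (𝓘(ℂ, E₁).prod 𝓘(ℂ, E₂)) 𝓘(ℂ) ω f (p, q))
    (v : TangentSpace 𝓘(ℂ, E₁) p) (w : TangentSpace 𝓘(ℂ, E₂) q) :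
    dirDeriv (fun x ↦ dirDeriv (fun y ↦ f (x, y)) q w) p v =
      dirDeriv (fun y ↦ dirDeriv (fun x ↦ f (x, y)) p v) q w := by
  have hswap : ContMDiffAt (𝓘(ℂ, E₂).prod 𝓘(ℂ, E₁)) 𝓘(ℂ) ω (fun z : N × M ↦ f (z.2, z.1))
      (q, p) :=
    ContMDiffAt.comp (q, p) (f := fun z : N × M ↦ (z.2, z.1)) hf
      (contMDiff_snd.prodMk contMDiff_fst).contMDiffAt
  obtain ⟨h1, h2⟩ := dirDeriv_dirDeriv_eq hf v w
  rw [h2, (dirDeriv_dirDeriv_eq hswap w v).2]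
  exact fderiv_fderiv_comm h1 v w

end MixedDerivatives

/-! ### The adjoint action -/

section Adjoint

open VectorField

variable {E G : Type*} [NormedAddCommGroup E] [NormedSpace ℂ E] [TopologicalSpace G]
  [ChartedSpace E G] [Group G] [LieGroup 𝓘(ℂ, E) ω G]

theorem contMDiff_mul_mul (g g' : G) : ContMDiff 𝓘(ℂ, E) 𝓘(ℂ, E) ω (fun k : G ↦ g * k * g') :=
  (contMDiff_mul_right (a := g')).comp (contMDiff_mul_left (a := g))

theorem mdifferentiableAt_mul_mul (g g' k : G) :
    MDifferentiableAt 𝓘(ℂ, E) 𝓘(ℂ, E) (fun k : G ↦ g * k * g') k :=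
  (contMDiff_mul_mul g g').mdifferentiableAt (by simp)

/-- The adjoint action of `g ∈ G` on the Lie algebra: the derivative at `1` of conjugation by `g`,
as a linear map. -/
def adLin (g : G) : GroupLieAlgebra 𝓘(ℂ, E) G →ₗ[ℂ] GroupLieAlgebra 𝓘(ℂ, E) G where
  toFun X := (mfderiv 𝓘(ℂ, E) 𝓘(ℂ, E) (fun k : G ↦ g * k * g⁻¹) 1 : E →L[ℂ] E) X
  map_add' X Z := map_add (mfderiv 𝓘(ℂ, E) 𝓘(ℂ, E) (fun k : G ↦ g * k * g⁻¹) 1) X Z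
  map_smul' c X := map_smul (mfderiv 𝓘(ℂ, E) 𝓘(ℂ, E) (fun k : G ↦ g * k * g⁻¹) 1) c X

theorem mfderiv_conj_comp {g g' : G} (hg : g' * g = 1) (k : G) :
    (mfderiv 𝓘(ℂ, E) 𝓘(ℂ, E) (fun x : G ↦ g' * x * g) (g * k * g')).comp
      (mfderiv 𝓘(ℂ, E) 𝓘(ℂ, E) (fun x : G ↦ g * x * g') k) = ContinuousLinearMap.id ℂ E := by
  have h := mfderiv_comp k (mdifferentiableAt_mul_mul (E := E) g' g (g * k * g'))
    (mdifferentiableAt_mul_mul (E := E) g g' k)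
  obtain rfl := eq_inv_of_mul_eq_one_left hg
  rw [← h, show (fun x : G ↦ g⁻¹ * x * g) ∘ (fun x : G ↦ g * x * g⁻¹) = id by
    ext x; simp [mul_assoc], mfderiv_id]
  rfl

theorem inverse_mfderiv_conj (g k : G) :
    (mfderiv 𝓘(ℂ, E) 𝓘(ℂ, E) (fun x : G ↦ g * x * g⁻¹) k).inverse =
      mfderiv 𝓘(ℂ, E) 𝓘(ℂ, E) (fun x : G ↦ g⁻¹ * x * g) (g * k * g⁻¹) := by
  refine ContinuousLinearMap.inverse_eq ?_ (mfderiv_conj_comp (inv_mul_cancel g) k)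
  have h := mfderiv_conj_comp (E := E) (mul_inv_cancel g) (g * k * g⁻¹)
  rwa [show g⁻¹ * (g * k * g⁻¹) * g = k by simp [mul_assoc]] at h

theorem adLin_surjective (g : G) : Function.Surjective (adLin (E := E) g) := by
  have h := mfderiv_conj_comp (E := E) (mul_inv_cancel g) 1
  intro X
  refine ⟨(mfderiv 𝓘(ℂ, E) 𝓘(ℂ, E) (fun x : G ↦ g⁻¹ * x * g) 1 : E →L[ℂ] E) X, ?_⟩
  rw [show g⁻¹ * 1 * g = 1 by simp] at h
  exact DFunLike.congr_fun h X

theorem mulInvariantVectorField_adLin (g k : G) (X : GroupLieAlgebra 𝓘(ℂ, E) G) :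
    mulInvariantVectorField (adLin g X) (g * k * g⁻¹) =
      mfderiv 𝓘(ℂ, E) 𝓘(ℂ, E) (fun x : G ↦ g * x * g⁻¹) k (mulInvariantVectorField X k) := by
  have hl : ∀ a b : G, MDifferentiableAt 𝓘(ℂ, E) 𝓘(ℂ, E) (fun x : G ↦ a * x) b := fun a b ↦
    (contMDiff_mul_left (I := 𝓘(ℂ, E)) (n := ω)).mdifferentiableAt (by simp)
  have h1 := mfderiv_comp (I' := 𝓘(ℂ, E)) (1 : G) (hl (g * k * g⁻¹) (g * 1 * g⁻¹))
    (mdifferentiableAt_mul_mul (E := E) g g⁻¹ 1)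
  have h2 := mfderiv_comp (I' := 𝓘(ℂ, E)) (1 : G) (mdifferentiableAt_mul_mul (E := E) g g⁻¹ (k * 1))
    (hl k 1)
  have h3 : (fun x : G ↦ g * k * g⁻¹ * x) ∘ (fun x : G ↦ g * x * g⁻¹) =
      (fun x : G ↦ g * x * g⁻¹) ∘ (fun x : G ↦ k * x) := by
    ext x; simp [mul_assoc]
  rw [h3, h2] at h1
  rw [show g * 1 * g⁻¹ = 1 by simp, mul_one] at h1
  exact (DFunLike.congr_fun h1 X).symm

theorem mpullback_conj_mulInvariantVectorField (g : G) (X : GroupLieAlgebra 𝓘(ℂ, E) G) :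
    mpullback 𝓘(ℂ, E) 𝓘(ℂ, E) (fun x : G ↦ g * x * g⁻¹) (mulInvariantVectorField (adLin g X)) =
      mulInvariantVectorField X := by
  ext k
  rw [mpullback_apply, inverse_mfderiv_conj, mulInvariantVectorField_adLin]
  exact DFunLike.congr_fun (mfderiv_conj_comp (E := E) (inv_mul_cancel g) k) _

theorem mfderiv_inv_one (X : GroupLieAlgebra 𝓘(ℂ, E) G) :
    (mfderiv 𝓘(ℂ, E) 𝓘(ℂ, E) (fun k : G ↦ k⁻¹) 1 : E →L[ℂ] E) X = -X := by
  have hinv : MDifferentiableAt 𝓘(ℂ, E) 𝓘(ℂ, E) (fun k : G ↦ k⁻¹) 1 :=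
    (contMDiff_inv 𝓘(ℂ, E) ω).mdifferentiableAt (by simp)
  have hmul : MDifferentiableAt (𝓘(ℂ, E).prod 𝓘(ℂ, E)) 𝓘(ℂ, E) (fun p : G × G ↦ p.1 * p.2)
      (1, 1⁻¹) := (contMDiff_mul 𝓘(ℂ, E) ω).mdifferentiableAt (by simp)
  have h1 := mfderiv_comp (1 : G) (f := fun k : G ↦ (k, k⁻¹)) hmul
    (mdifferentiableAt_id.prodMk hinv)
  rw [show (fun p : G × G ↦ p.1 * p.2) ∘ (fun k : G ↦ (k, k⁻¹)) = fun _ ↦ 1 by ext; simp,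
    mfderiv_const] at h1
  have hp : mfderiv 𝓘(ℂ, E) (𝓘(ℂ, E).prod 𝓘(ℂ, E)) (fun k : G ↦ (k, k⁻¹)) 1 =
      (mfderiv 𝓘(ℂ, E) 𝓘(ℂ, E) (id : G → G) 1).prod
        (mfderiv 𝓘(ℂ, E) 𝓘(ℂ, E) (fun k : G ↦ k⁻¹) 1) :=
    mfderiv_prodMk mdifferentiableAt_id hinv
  rw [mfderiv_id] at hp
  have h2 : (0 : E) = mfderiv 𝓘(ℂ, E) 𝓘(ℂ, E) (fun z : G ↦ z * 1⁻¹) 1 X +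
      mfderiv 𝓘(ℂ, E) 𝓘(ℂ, E) (fun z : G ↦ 1 * z) 1⁻¹
        ((mfderiv 𝓘(ℂ, E) 𝓘(ℂ, E) (fun k : G ↦ k⁻¹) 1 : E →L[ℂ] E) X) := by
    have h2 : (0 : E) = (mfderiv (𝓘(ℂ, E).prod 𝓘(ℂ, E)) 𝓘(ℂ, E) (fun p : G × G ↦ p.1 * p.2)
        (1, 1⁻¹) : E × E →L[ℂ] E) ((mfderiv 𝓘(ℂ, E) (𝓘(ℂ, E).prod 𝓘(ℂ, E))
          (fun k : G ↦ (k, k⁻¹)) 1 : E →L[ℂ] E × E) X) := DFunLike.congr_fun h1 X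
    refine (h2.trans (congrArg _ (DFunLike.congr_fun hp X))).trans
      (mfderiv_prod_eq_add_apply (I := 𝓘(ℂ, E)) (I' := 𝓘(ℂ, E)) hmul)
  have h3 : (fun z : G ↦ z * 1⁻¹) = id := by ext; simp
  have h4 : (fun z : G ↦ 1 * z) = id := by ext; simp
  rw [h3, h4, mfderiv_id, mfderiv_id] at h2
  exact (neg_eq_of_add_eq_zero_right h2.symm).symm

variable [CompleteSpace E]

/-- The adjoint action of `g ∈ G` on the Lie algebra, as a homomorphism of Lie algebras. -/
def adHom (g : G) : GroupLieAlgebra 𝓘(ℂ, E) G →ₗ⁅ℂ⁆ GroupLieAlgebra 𝓘(ℂ, E) G where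
  __ := adLin g
  map_lie' {X Z} := by
    change adLin g ⁅X, Z⁆ = ⁅adLin g X, adLin g Z⁆
    have h := mpullback_mlieBracket (x₀ := (1 : G)) (n := ω) (f := fun x : G ↦ g * x * g⁻¹)
      (V := mulInvariantVectorField (adLin g X)) (W := mulInvariantVectorField (adLin g Z))
      (mdifferentiableAt_mulInvariantVectorField (I := 𝓘(ℂ, E)) _)
      (mdifferentiableAt_mulInvariantVectorField (I := 𝓘(ℂ, E)) _)
      (contMDiff_mul_mul (E := E) g g⁻¹).contMDiffAt (by simp)
    rw [mpullback_conj_mulInvariantVectorField, mpullback_conj_mulInvariantVectorField,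
      mpullback_apply, inverse_mfderiv_conj, show g * 1 * g⁻¹ = 1 by simp] at h
    have h2 := mfderiv_conj_comp (E := E) (mul_inv_cancel g) 1
    rw [show g⁻¹ * 1 * g = 1 by simp] at h2
    exact (congrArg (adLin g) h).symm.trans (DFunLike.congr_fun h2 ⁅adLin g X, adLin g Z⁆)

end Adjoint

/-! ### Functions constant along an invariant polarization -/

section Polarization

variable {E F G M : Type*}
  [NormedAddCommGroup E] [NormedSpace ℂ E] [NormedAddCommGroup F] [NormedSpace ℂ F]
  [TopologicalSpace G] [ChartedSpace E G] [Group G]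
  [TopologicalSpace M] [ChartedSpace F M]
  [MulAction G M] [ContMDiffSMul 𝓘(ℂ, E) 𝓘(ℂ, F) ω G M]

theorem contMDiff_smul_right (x : M) :
    ContMDiff 𝓘(ℂ, E) 𝓘(ℂ, F) ω (fun k : G ↦ k • x) :=
  (ContMDiffSMul.contMDiff_smul (I := 𝓘(ℂ, E)) (I' := 𝓘(ℂ, F)) (n := ω)).comp
    (contMDiff_id.prodMk contMDiff_const)

variable [LieGroup 𝓘(ℂ, E) ω G]

theorem dirDeriv_comp_smul {U : Opens M} (a : HolFun F U) {o : M} {g : G} (hg : g • o ∈ U)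
    (X : GroupLieAlgebra 𝓘(ℂ, E) G) :
    dirDeriv (fun k : G ↦ a.ext ((g * k) • o)) 1 X =
      dirDeriv a.ext (g • o)
        (mfderiv 𝓘(ℂ, E) 𝓘(ℂ, F) (fun k : G ↦ k • o) g (mulInvariantVectorField X g)) := by
  have ha : MDifferentiableAt 𝓘(ℂ, F) 𝓘(ℂ) a.ext ((g * 1) • o) := by
    rw [mul_one]
    exact (a.contMDiffAt_ext hg).mdifferentiableAt (by simp)
  have ho : MDifferentiableAt 𝓘(ℂ, E) 𝓘(ℂ, F) (fun k : G ↦ k • o) (g * 1) :=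
    (contMDiff_smul_right o).mdifferentiableAt (by simp)
  have hl : MDifferentiableAt 𝓘(ℂ, E) 𝓘(ℂ, E) (fun k : G ↦ g * k) 1 :=
    (contMDiff_mul_left (I := 𝓘(ℂ, E)) (n := ω)).mdifferentiableAt (by simp)
  have h1 : mfderiv 𝓘(ℂ, E) 𝓘(ℂ) ((a.ext ∘ fun k : G ↦ k • o) ∘ fun k : G ↦ g * k) 1 = _ :=
    mfderiv_comp 1 (MDifferentiableAt.comp (g * 1) ha ho) hl
  rw [mfderiv_comp (g * 1) ha ho, mul_one] at h1
  exact DFunLike.congr_fun h1 X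

theorem contMDiff_inv_smul_right (x : M) :
    ContMDiff 𝓘(ℂ, E) 𝓘(ℂ, F) ω (fun k : G ↦ k⁻¹ • x) :=
  (contMDiff_smul_right x).comp (contMDiff_inv 𝓘(ℂ, E) ω)

/-- At `g o`, the action of `Ad(g) X` is the opposite of the derivative in the direction of the
left translate of `X`. -/
theorem lieActFun_adLin {U : Opens M} (a : HolFun F U) {o : M} {g : G} (hg : g • o ∈ U)
    (X : GroupLieAlgebra 𝓘(ℂ, E) G) :
    lieActFun (adLin g X) a (g • o) =
      -dirDeriv (fun k : G ↦ a.ext ((g * k) • o)) 1 X := by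
  have ha : ∀ k : G, k = 1 →
      MDifferentiableAt 𝓘(ℂ, E) 𝓘(ℂ) (fun k : G ↦ a.ext (k⁻¹ • g • o)) k := by
    rintro k rfl
    exact (contMDiffAt_orbitFun_right (E := E) a (by simpa using hg)).mdifferentiableAt (by simp)
  have hb : ∀ k : G, k = 1 →
      MDifferentiableAt 𝓘(ℂ, E) 𝓘(ℂ) (fun k : G ↦ a.ext ((g * k) • o)) k := by
    rintro k rfl
    have h1 : ContMDiff 𝓘(ℂ, E) 𝓘(ℂ, F) ω (fun k : G ↦ (g * k) • o) :=
      (contMDiff_smul_right o).comp contMDiff_mul_left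
    refine MDifferentiableAt.comp (f := fun k : G ↦ (g * k) • o) 1
      ((a.contMDiffAt_ext ?_).mdifferentiableAt (by simp)) (h1.mdifferentiableAt (by simp))
    simpa using hg
  have hinv : MDifferentiableAt 𝓘(ℂ, E) 𝓘(ℂ, E) (fun k : G ↦ k⁻¹) 1 :=
    (contMDiff_inv 𝓘(ℂ, E) ω).mdifferentiableAt (by simp)
  have h1 := mfderiv_comp 1 (ha (g * 1 * g⁻¹) (by simp))
    (mdifferentiableAt_mul_mul (E := E) g g⁻¹ 1)
  have h2 := mfderiv_comp 1 (hb 1⁻¹ (by simp)) hinv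
  have h3 : (fun k : G ↦ a.ext (k⁻¹ • g • o)) ∘ (fun k : G ↦ g * k * g⁻¹) =
      (fun k : G ↦ a.ext ((g * k) • o)) ∘ fun k : G ↦ k⁻¹ := by
    ext k
    simp [← mul_smul, mul_assoc]
  rw [h3, h2] at h1
  rw [show g * 1 * g⁻¹ = 1 by simp, inv_one] at h1
  have h4 : dirDeriv (fun k : G ↦ a.ext ((g * k) • o)) 1
      ((mfderiv 𝓘(ℂ, E) 𝓘(ℂ, E) (fun k : G ↦ k⁻¹) 1 : E →L[ℂ] E) X) =
      lieActFun (adLin g X) a (g • o) := DFunLike.congr_fun h1 X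
  rw [← h4, mfderiv_inv_one]
  exact map_neg (mfderiv 𝓘(ℂ, E) 𝓘(ℂ) (fun k : G ↦ a.ext ((g * k) • o)) 1) X

variable {o : M} {𝔫 : Submodule ℂ (GroupLieAlgebra 𝓘(ℂ, E) G)} {U : Opens M}

theorem mem_constantAlong_iff {a : HolFun F U} :
    a ∈ constantAlong (polarization F o 𝔫) U ↔ ∀ g : G, g • o ∈ U → ∀ X ∈ 𝔫,
      dirDeriv (fun k : G ↦ a.ext ((g * k) • o)) 1 X = 0 := by
  constructor
  · intro ha g hg X hX
    rw [dirDeriv_comp_smul a hg]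
    exact ha _ ⟨g, X, hX, rfl⟩ hg
  · rintro ha v ⟨g, X, hX, rfl⟩ hg
    exact (dirDeriv_comp_smul a hg X).symm.trans (ha g hg X hX)

theorem lieActFun_adLin_eq_zero {a : HolFun F U} (ha : a ∈ constantAlong (polarization F o 𝔫) U)
    {g : G} (hg : g • o ∈ U) {X : GroupLieAlgebra 𝓘(ℂ, E) G}
    (hX : X ∈ isotropySub G E F o ⊔ 𝔫) : lieActFun (adLin g X) a (g • o) = 0 := by
  rw [lieActFun_adLin a hg, neg_eq_zero]
  obtain ⟨Z, hZ, X, hX𝔫, rfl⟩ := Submodule.mem_sup.1 hX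
  have h0 : dirDeriv (fun k : G ↦ a.ext ((g * k) • o)) 1 Z = 0 := by
    have ha' : MDifferentiableAt 𝓘(ℂ, F) 𝓘(ℂ) (fun x : M ↦ a.ext (g • x)) ((1 : G) • o) := by
      have h1 : ContMDiff 𝓘(ℂ, F) 𝓘(ℂ, F) ω (fun x : M ↦ g • x) :=
        (ContMDiffSMul.contMDiff_smul (I := 𝓘(ℂ, E)) (I' := 𝓘(ℂ, F)) (n := ω)).comp
          (contMDiff_const.prodMk contMDiff_id)
      exact MDifferentiableAt.comp (f := fun x : M ↦ g • x) _
        ((a.contMDiffAt_ext (by simpa using hg)).mdifferentiableAt (by simp))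
        (h1.mdifferentiableAt (by simp))
    have ho : MDifferentiableAt 𝓘(ℂ, E) 𝓘(ℂ, F) (fun k : G ↦ k • o) 1 :=
      (contMDiff_smul_right o).mdifferentiableAt (by simp)
    have h2 := mfderiv_comp 1 ha' ho
    rw [show (fun x : M ↦ a.ext (g • x)) ∘ (fun k : G ↦ k • o) =
      fun k : G ↦ a.ext ((g * k) • o) by ext k; simp [mul_smul]] at h2
    refine (DFunLike.congr_fun h2 Z).trans ?_
    have hZ' : mfderiv 𝓘(ℂ, E) 𝓘(ℂ, F) (fun k : G ↦ k • o) 1 Z = 0 := hZ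
    exact (congrArg (mfderiv 𝓘(ℂ, F) 𝓘(ℂ) (fun x : M ↦ a.ext (g • x)) ((1 : G) • o)) hZ').trans
      (map_zero _)
  refine (map_add (mfderiv 𝓘(ℂ, E) 𝓘(ℂ) (fun k : G ↦ a.ext ((g * k) • o)) 1) Z X).trans ?_
  exact (congrArg₂ (· + ·) h0 (mem_constantAlong_iff.1 ha g hg X hX𝔫)).trans (add_zero _)

variable [IsManifold 𝓘(ℂ, F) ω M]

/-- The action of the Lie algebra preserves the functions constant along a polarization, since left
and right translations commute. -/
theorem lieAct_mem_constantAlong {a : HolFun F U} (ha : a ∈ constantAlong (polarization F o 𝔫) U)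
    (Z : GroupLieAlgebra 𝓘(ℂ, E) G) : lieAct Z a ∈ constantAlong (polarization F o 𝔫) U := by
  rw [mem_constantAlong_iff] at ha ⊢
  intro g hg X hX
  have hG : IsManifold 𝓘(ℂ, E) ω G := inferInstance
  let Φ : G × G → ℂ := fun p ↦ a.ext (p.2⁻¹ • (g * p.1) • o)
  have hsm : ContMDiff (𝓘(ℂ, E).prod 𝓘(ℂ, E)) 𝓘(ℂ, F) ω
      (fun p : G × G ↦ p.2⁻¹ • (g * p.1) • o) := by
    have h1 : ContMDiff (𝓘(ℂ, E).prod 𝓘(ℂ, E)) 𝓘(ℂ, E) ω (fun p : G × G ↦ p.2⁻¹ * (g * p.1)) :=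
      ((contMDiff_inv 𝓘(ℂ, E) ω).comp contMDiff_snd).mul (contMDiff_mul_left.comp contMDiff_fst)
    simp only [← mul_smul]
    exact (contMDiff_smul_right (F := F) o).comp h1
  have hΦ : ContMDiffAt (𝓘(ℂ, E).prod 𝓘(ℂ, E)) 𝓘(ℂ) ω Φ (1, 1) :=
    ContMDiffAt.comp (1, 1) (a.contMDiffAt_ext (by simpa using hg)) hsm.contMDiffAt
  have h1 : (fun k : G ↦ (lieAct Z a).ext ((g * k) • o)) =ᶠ[𝓝 1]
      fun k ↦ dirDeriv (fun z ↦ Φ (k, z)) 1 Z := by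
    have hc : Filter.Tendsto (fun k : G ↦ (g * k) • o) (𝓝 1) (𝓝 (g • o)) := by
      have := ((contMDiff_smul_right (E := E) (F := F) o).comp
        (contMDiff_mul_left (I := 𝓘(ℂ, E)) (n := ω) (a := g))).continuous.tendsto 1
      simpa only [Function.comp_def, mul_one] using this
    filter_upwards [hc.eventually (U.isOpen.mem_nhds hg)] with k hk
    rw [HolFun.ext_apply _ hk, lieAct_apply]
    rfl
  have h2 : (fun z : G ↦ dirDeriv (fun k ↦ Φ (k, z)) 1 X) =ᶠ[𝓝 1] fun _ ↦ 0 := by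
    have hc : Filter.Tendsto (fun k : G ↦ k⁻¹ • g • o) (𝓝 1) (𝓝 (g • o)) := by
      have := (contMDiff_inv_smul_right (E := E) (F := F) (G := G) (g • o)).continuous.tendsto 1
      rwa [inv_one, one_smul] at this
    filter_upwards [hc.eventually (U.isOpen.mem_nhds hg)] with z hz
    have := ha (z⁻¹ * g) (by rw [mul_smul]; exact hz) X hX
    rw [← this]
    congr 1
    ext k
    simp [Φ, mul_smul]
  have h3 := dirDeriv_dirDeriv_comm hΦ X Z
  unfold dirDeriv at h1 h2 h3 ⊢
  rw [h1.mfderiv_eq]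
  refine h3.trans ?_
  rw [h2.mfderiv_eq, mfderiv_const]
  rfl

end Polarization

/-! ### Jets and the action of the Lie algebra -/

section NormedJets

variable {F : Type*} [NormedAddCommGroup F] [NormedSpace ℂ F]

/-- If the derivatives of `f` of orders `1, …, k` vanish at `z`, then the `k`-th derivative at `z`
of the derivative of `f` along a vector field depends only on the value of the field at `z`. -/
theorem iteratedFDeriv_fderiv_apply_eq {f : F → ℂ} {z : F} {ξ : F → F} (hf : ContDiffAt ℂ ω f z)
    (hξ : ContDiffAt ℂ ω ξ z) {k : ℕ} (h0 : ∀ i, 1 ≤ i → i ≤ k → iteratedFDeriv ℂ i f z = 0) :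
    iteratedFDeriv ℂ k (fun x ↦ fderiv ℂ f x (ξ x)) z =
      iteratedFDeriv ℂ k (fun x ↦ fderiv ℂ f x (ξ z)) z := by
  have hf' : ContDiffAt ℂ k (fderiv ℂ f) z := hf.fderiv_right (m := k) le_top
  have hη : ContDiffAt ℂ k (fun x ↦ ξ x - ξ z) z := (hξ.of_le le_top).sub contDiffAt_const
  have h1 : iteratedFDeriv ℂ k (fun x ↦ fderiv ℂ f x (ξ x - ξ z)) z = 0 := by
    obtain ⟨u, hu, hzu, hfu⟩ := hf'.contDiffOn' le_rfl (by simp)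
    obtain ⟨u', hu', hzu', hηu⟩ := hη.contDiffOn' le_rfl (by simp)
    rw [Set.insert_eq_of_mem (Set.mem_univ _), Set.univ_inter] at hfu hηu
    have ho : IsOpen (u ∩ u') := hu.inter hu'
    have hz : z ∈ u ∩ u' := ⟨hzu, hzu'⟩
    have hb := norm_iteratedFDerivWithin_clm_apply (hfu.mono Set.inter_subset_left)
      (hηu.mono Set.inter_subset_right) ho.uniqueDiffOn hz (le_refl (k : ℕ∞ω))
    simp only [iteratedFDerivWithin_of_isOpen _ ho hz] at hb
    rw [← norm_le_zero_iff]
    refine hb.trans (Finset.sum_nonpos fun i hi ↦ le_of_eq ?_)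
    rcases (Nat.lt_succ_iff.1 (Finset.mem_range.1 hi)).lt_or_eq with hik | rfl
    · rw [norm_iteratedFDeriv_fderiv, h0 (i + 1) (by lia) hik, norm_zero, mul_zero, zero_mul]
    · rw [Nat.sub_self, norm_iteratedFDeriv_zero, sub_self, norm_zero, mul_zero]
  have h2 : (fun x ↦ fderiv ℂ f x (ξ x)) =
      (fun x ↦ fderiv ℂ f x (ξ x - ξ z)) + fun x ↦ fderiv ℂ f x (ξ z) := by
    ext x
    simp
  rw [h2, iteratedFDeriv_add_apply (hf'.clm_apply hη) (hf'.clm_apply contDiffAt_const), h1,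
    zero_add]

/-- The inductive step for the vanishing of jets: to kill the derivative of order `k + 1` it is
enough to kill the `k`-th derivatives of the derivatives along fields spanning the tangent space. -/
theorem iteratedFDeriv_succ_eq_zero {f : F → ℂ} {z : F} (hf : ContDiffAt ℂ ω f z) {k : ℕ}
    (h0 : ∀ i, 1 ≤ i → i ≤ k → iteratedFDeriv ℂ i f z = 0)
    (hξ : ∀ v : F, ∃ ξ : F → F, ContDiffAt ℂ ω ξ z ∧ ξ z = v ∧
      iteratedFDeriv ℂ k (fun x ↦ fderiv ℂ f x (ξ x)) z = 0) :
    iteratedFDeriv ℂ (k + 1) f z = 0 := by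
  rw [← norm_eq_zero, ← norm_iteratedFDeriv_fderiv, norm_eq_zero]
  ext m v
  obtain ⟨ξ, hs, hv, h⟩ := hξ v
  rw [iteratedFDeriv_fderiv_apply_eq hf hs h0, hv] at h
  have hf' : ContDiffAt ℂ k (fderiv ℂ f) z := hf.fderiv_right (m := k) le_top
  have h1 := (ContinuousLinearMap.apply ℂ ℂ v).iteratedFDeriv_comp_left hf' (le_refl (k : ℕ∞ω))
  have h2 : (ContinuousLinearMap.apply ℂ ℂ v) ∘ fderiv ℂ f = fun x ↦ fderiv ℂ f x v := rfl
  rw [h2, h] at h1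
  exact (DFunLike.congr_fun h1 m).symm

end NormedJets

section Jets

attribute [local instance] LieRing.ofAssociativeRing

variable {E F G M : Type*}
  [NormedAddCommGroup E] [NormedSpace ℂ E] [NormedAddCommGroup F] [NormedSpace ℂ F]
  [TopologicalSpace G] [ChartedSpace E G] [Group G] [LieGroup 𝓘(ℂ, E) ω G]
  [TopologicalSpace M] [ChartedSpace F M]
  [MulAction G M] [ContMDiffSMul 𝓘(ℂ, E) 𝓘(ℂ, F) ω G M]

theorem contDiffAt_ext_comp_symm {U : Opens M} (a : HolFun F U) {y : M} (hy : y ∈ U) :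
    ContDiffAt ℂ ω (a.ext ∘ (extChartAt 𝓘(ℂ, F) y).symm) (extChartAt 𝓘(ℂ, F) y y) := by
  have h1 := contMDiffAt_iff_source.1 (a.contMDiffAt_ext hy)
  rw [ModelWithCorners.range_eq_univ, contMDiffWithinAt_univ] at h1
  exact h1.contDiffAt

/-- The map `(k, x) ↦ k⁻¹ x` in the chart of `M` at `y` and the chart of `G` at `1`. -/
def actionInCharts (E G : Type*) {F M : Type*} [NormedAddCommGroup E] [NormedSpace ℂ E]
    [NormedAddCommGroup F] [NormedSpace ℂ F] [TopologicalSpace G] [ChartedSpace E G] [Group G]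
    [TopologicalSpace M] [ChartedSpace F M] [MulAction G M] (y : M) (w : F) (e : E) : F :=
  extChartAt 𝓘(ℂ, F) y
    (((extChartAt 𝓘(ℂ, E) (1 : G)).symm e)⁻¹ • (extChartAt 𝓘(ℂ, F) y).symm w)

/-- The vector field on `M` induced by an element `X` of the Lie algebra, in the chart at `y`. -/
def fundamentalField (y : M) (X : GroupLieAlgebra 𝓘(ℂ, E) G) (w : F) : F :=
  fderiv ℂ (actionInCharts E G y w) (extChartAt 𝓘(ℂ, E) (1 : G) 1) X

theorem fundamentalField_surjective {y : M}
    (hy : Function.Surjective (mfderiv 𝓘(ℂ, E) 𝓘(ℂ, F) (fun k : G ↦ k⁻¹ • y) 1)) (v : F) :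
    ∃ X : GroupLieAlgebra 𝓘(ℂ, E) G,
      fundamentalField (F := F) y X (extChartAt 𝓘(ℂ, F) y y) = v := by
  obtain ⟨X, hX⟩ := hy v
  refine ⟨X, Eq.trans ?_ hX⟩
  have hmd : MDifferentiableAt 𝓘(ℂ, E) 𝓘(ℂ, F) (fun k : G ↦ k⁻¹ • y) 1 :=
    (contMDiff_inv_smul_right y).mdifferentiableAt (by simp)
  have h1 : writtenInExtChartAt 𝓘(ℂ, E) 𝓘(ℂ, F) (1 : G) (fun k : G ↦ k⁻¹ • y) =
      actionInCharts E G y (extChartAt 𝓘(ℂ, F) y y) := by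
    ext e
    rw [actionInCharts, extChartAt_to_inv, writtenInExtChartAt, inv_one, one_smul]
    rfl
  rw [hmd.mfderiv, ModelWithCorners.range_eq_univ, fderivWithin_univ, h1]
  rfl

variable [IsManifold 𝓘(ℂ, F) ω M]

theorem contDiffAt_actionInCharts (y : M) :
    ContDiffAt ℂ ω (Function.uncurry (actionInCharts E G (F := F) y))
      (extChartAt 𝓘(ℂ, F) y y, extChartAt 𝓘(ℂ, E) (1 : G) 1) := by
  have hG : IsManifold 𝓘(ℂ, E) ω G := inferInstance
  have h := (contMDiffAt_iff_of_mem_source (x := (y, (1 : G))) (x' := (y, (1 : G))) (y := y)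
    (mem_chart_source _ _) (by simp)).1
    (contMDiff_inv_smul (E := E) (F := F) (G := G) (M := M)).contMDiffAt
  have h2 := h.2
  rw [ModelWithCorners.range_eq_univ, contDiffWithinAt_univ, extChartAt_prod] at h2
  exact h2

theorem contDiffAt_fundamentalField (y : M) (X : GroupLieAlgebra 𝓘(ℂ, E) G) :
    ContDiffAt ℂ ω (fundamentalField (F := F) y X) (extChartAt 𝓘(ℂ, F) y y) :=
  ((contDiffAt_actionInCharts (E := E) (G := G) y).fderiv contDiffAt_const
    (m := ω) le_top).clm_apply contDiffAt_const

/-- In charts, the action of `X` is the derivative along the induced vector field. -/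
theorem lieAct_ext_comp_symm {U : Opens M} (a : HolFun F U) {y : M} (hy : y ∈ U)
    (X : GroupLieAlgebra 𝓘(ℂ, E) G) :
    (lieAct X a).ext ∘ (extChartAt 𝓘(ℂ, F) y).symm =ᶠ[𝓝 (extChartAt 𝓘(ℂ, F) y y)] fun w ↦
      fderiv ℂ (a.ext ∘ (extChartAt 𝓘(ℂ, F) y).symm) w (fundamentalField y X w) := by
  have hG : IsManifold 𝓘(ℂ, E) ω G := inferInstance
  set φ := extChartAt 𝓘(ℂ, F) y with hφ
  set ψ := extChartAt 𝓘(ℂ, E) (1 : G) with hψ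
  have hsymm : Filter.Tendsto φ.symm (𝓝 (φ y)) (𝓝 y) := by
    have := (continuousAt_extChartAt_symm (I := 𝓘(ℂ, F)) y).tendsto
    rwa [← hφ, hφ, extChartAt_to_inv] at this
  have h1 : ∀ᶠ w in 𝓝 (φ y), DifferentiableAt ℂ (a.ext ∘ φ.symm) w := by
    filter_upwards [(contDiffAt_ext_comp_symm a hy).eventually (by simp)] with w hw
    exact hw.differentiableAt (by simp)
  have h2 : ∀ᶠ w in 𝓝 (φ y), DifferentiableAt ℂ (actionInCharts E G y w) (ψ 1) := by
    have h3 : Filter.Tendsto (fun w ↦ (w, ψ 1)) (𝓝 (φ y)) (𝓝 (φ y, ψ 1)) :=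
      (Continuous.prodMk_left (ψ 1)).tendsto (φ y)
    filter_upwards [h3.eventually
      ((contDiffAt_actionInCharts (E := E) (G := G) y).eventually (by simp))] with w hw
    exact (hw.differentiableAt (by simp)).comp (ψ 1)
      (hasFDerivAt_prodMk_right w (ψ 1)).differentiableAt
  filter_upwards [h1, h2, hsymm.eventually (U.isOpen.mem_nhds hy),
    extChartAt_target_mem_nhds (I := 𝓘(ℂ, F)) y] with w hw1 hw2 hwU hwt
  have hwU' : φ.symm w ∈ U := hwU
  have hone : actionInCharts E G y w (ψ 1) = w := by
    rw [actionInCharts, hψ, extChartAt_to_inv, inv_one, one_smul]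
    exact φ.right_inv hwt
  have hev : (fun k : G ↦ a.ext (k⁻¹ • φ.symm w)) ∘ ψ.symm =ᶠ[𝓝 (ψ 1)]
      (a.ext ∘ φ.symm) ∘ actionInCharts E G y w := by
    have h4 : Filter.Tendsto (fun e ↦ (ψ.symm e)⁻¹ • φ.symm w) (𝓝 (ψ 1)) (𝓝 (φ.symm w)) := by
      have h5 := (continuousAt_extChartAt_symm (I := 𝓘(ℂ, E)) (1 : G)).tendsto
      rw [extChartAt_to_inv] at h5
      have h6 :=
        (contMDiff_inv_smul_right (E := E) (F := F) (G := G) (φ.symm w)).continuous.tendsto 1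
      rw [inv_one, one_smul] at h6
      exact h6.comp h5
    have hs : φ.source ∈ 𝓝 (φ.symm w) :=
      (isOpen_extChartAt_source (I := 𝓘(ℂ, F)) y).mem_nhds (φ.map_target hwt)
    filter_upwards [h4.eventually hs] with e he
    simp only [Function.comp, actionInCharts]
    rw [φ.left_inv he]
  have hmd : MDifferentiableAt 𝓘(ℂ, E) 𝓘(ℂ) (fun k : G ↦ a.ext (k⁻¹ • φ.symm w)) 1 :=
    (contMDiffAt_orbitFun_right (E := E) a (by simpa using hwU')).mdifferentiableAt (by simp)
  have hd1 : DifferentiableAt ℂ (a.ext ∘ φ.symm) (actionInCharts E G y w (ψ 1)) := by rwa [hone]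
  rw [Function.comp, HolFun.ext_apply _ hwU', lieAct_apply]
  change dirDeriv (fun k : G ↦ a.ext (k⁻¹ • φ.symm w)) 1 X = _
  rw [dirDeriv_eq_fderiv hmd, hev.fderiv_eq, fderiv_comp _ hd1 hw2, hone]
  rfl

variable [CompleteSpace E]

/-- If the induced vector fields span the tangent space at `y`, then a function whose derivatives
along all words of length at most `k` in the Lie algebra vanish at `y` has a vanishing `k`-jet at
`y`. -/
theorem iteratedFDeriv_eq_zero_of_wordAct {U : Opens M} {y : M} (hy : y ∈ U)
    (hsurj : Function.Surjective (mfderiv 𝓘(ℂ, E) 𝓘(ℂ, F) (fun k : G ↦ k⁻¹ • y) 1)) (k : ℕ)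
    {a : HolFun F U} (ha : ∀ l : List (GroupLieAlgebra 𝓘(ℂ, E) G), l.length ≤ k →
      wordAct (lieRep (E := E) (G := G) U) l a ⟨y, hy⟩ = 0) :
    ∀ i ≤ k, iteratedFDeriv ℂ i (a.ext ∘ (extChartAt 𝓘(ℂ, F) y).symm)
      (extChartAt 𝓘(ℂ, F) y y) = 0 := by
  induction k generalizing a with
  | zero =>
    intro i hi
    obtain rfl := Nat.le_zero.1 hi
    rw [← norm_eq_zero, norm_iteratedFDeriv_zero, norm_eq_zero, Function.comp, extChartAt_to_inv,
      HolFun.ext_apply _ hy]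
    exact ha [] le_rfl
  | succ k ih =>
    have h1 := ih fun l hl ↦ ha l (by lia)
    intro i hi
    rcases Nat.le_succ_iff.1 hi with hi | rfl
    · exact h1 i hi
    refine iteratedFDeriv_succ_eq_zero (contDiffAt_ext_comp_symm a hy) (fun i _ hi ↦ h1 i hi)
      fun v ↦ ?_
    obtain ⟨X, hX⟩ := fundamentalField_surjective hsurj v
    refine ⟨fundamentalField y X, contDiffAt_fundamentalField y X, hX, ?_⟩
    have h2 := ih (a := lieAct X a) (fun l hl ↦ by
      have := ha (l ++ [X]) (by simpa using hl)
      rwa [wordAct_append, wordAct_cons, wordAct_nil, mul_one] at this) k le_rfl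
    rwa [← ((lieAct_ext_comp_symm a hy X).iteratedFDeriv ℂ k).eq_of_nhds]

end Jets

/-! ### Invariant bidifferential operators on functions constant along a polarization -/

section Vanishing

attribute [local instance] LieRing.ofAssociativeRing

variable {E F G M : Type*}
  [NormedAddCommGroup E] [NormedSpace ℂ E] [NormedAddCommGroup F] [NormedSpace ℂ F]
  [TopologicalSpace G] [ChartedSpace E G] [Group G]
  [TopologicalSpace M] [ChartedSpace F M] [MulAction G M]

theorem HolFun.ext_eventuallyEq_of_forall {U : Opens M} {a : HolFun F U} {f : M → ℂ}
    (h : ∀ y : U, a y = f y) {x : M} (hx : x ∈ U) : a.ext =ᶠ[𝓝 x] f := by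
  filter_upwards [U.isOpen.mem_nhds hx] with y hy
  rw [a.ext_apply hy]
  exact h ⟨y, hy⟩

/-- The functions constant along a set of tangent vectors, as a linear subspace of `𝒜(U)`. -/
def constantAlongSubmodule (T : Set (TangentBundle 𝓘(ℂ, F) M)) (U : Opens M) :
    Submodule ℂ (HolFun F U) where
  carrier := constantAlong T U
  zero_mem' v _ hU := by
    have h := HolFun.ext_eventuallyEq_of_forall (a := (0 : HolFun F U)) (f := fun _ ↦ 0)
      (fun _ ↦ rfl) hU
    rw [dirDeriv, h.mfderiv_eq, mfderiv_const]
    rfl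
  add_mem' {a b} ha hb v hv hU := by
    have h := HolFun.ext_eventuallyEq_of_forall (a := a + b) (f := a.ext + b.ext)
      (fun y ↦ by rw [Pi.add_apply, a.ext_apply y.2, b.ext_apply y.2]; rfl) hU
    have h1 := ha v hv hU
    have h2 := hb v hv hU
    unfold dirDeriv at h1 h2 ⊢
    rw [h.mfderiv_eq, mfderiv_add ((a.contMDiffAt_ext hU).mdifferentiableAt (by simp))
      ((b.contMDiffAt_ext hU).mdifferentiableAt (by simp))]
    exact (congrArg₂ (· + ·) h1 h2).trans (add_zero _)
  smul_mem' c a ha v hv hU := by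
    have h := HolFun.ext_eventuallyEq_of_forall (a := c • a) (f := c • a.ext)
      (fun y ↦ by rw [Pi.smul_apply, a.ext_apply y.2]; rfl) hU
    have h1 := ha v hv hU
    unfold dirDeriv at h1 ⊢
    rw [h.mfderiv_eq, const_smul_mfderiv ((a.contMDiffAt_ext hU).mdifferentiableAt (by simp))]
    exact (congrArg (c • ·) h1).trans (smul_zero _)

theorem one_mem_constantAlong (T : Set (TangentBundle 𝓘(ℂ, F) M)) (U : Opens M) :
    (1 : HolFun F U) ∈ constantAlong T U := by
  intro v _ hU
  have h := HolFun.ext_eventuallyEq_of_forall (a := (1 : HolFun F U)) (f := fun _ ↦ 1)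
    (fun _ ↦ rfl) hU
  rw [dirDeriv, h.mfderiv_eq, mfderiv_const]
  rfl

/-- A bidifferential operator depends only on the jets of bounded order of its arguments. -/
theorem BidiffOp.exists_order (ν : BidiffOp F M) (y : M) :
    ∃ k : ℕ, ∀ (U : Opens M) (hy : y ∈ U) (a b : HolFun F U),
      ((∀ i ≤ k, iteratedFDeriv ℂ i (a.ext ∘ (extChartAt 𝓘(ℂ, F) y).symm)
          (extChartAt 𝓘(ℂ, F) y y) = 0) ∨
        ∀ i ≤ k, iteratedFDeriv ℂ i (b.ext ∘ (extChartAt 𝓘(ℂ, F) y).symm)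
          (extChartAt 𝓘(ℂ, F) y y) = 0) →
      ν.op U a b ⟨y, hy⟩ = 0 := by
  obtain ⟨V, hyV, -, k, C, -, hC⟩ := ν.local_formula y
  refine ⟨k, fun U hy a b h ↦ ?_⟩
  rw [hC U a b ⟨y, hy⟩ hyV]
  refine Finset.sum_eq_zero fun i hi ↦ Finset.sum_eq_zero fun j hj ↦ ?_
  have hi' := Nat.lt_succ_iff.1 (Finset.mem_range.1 hi)
  have hj' := Nat.lt_succ_iff.1 (Finset.mem_range.1 hj)
  rcases h with h | h
  · have := h i hi'
    simp only [mfld_simps] at this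
    rw [this, map_zero, LinearMap.zero_apply]
  · have := h j hj'
    simp only [mfld_simps] at this
    rw [this, map_zero]

variable [LieGroup 𝓘(ℂ, E) ω G] [ContMDiffSMul 𝓘(ℂ, E) 𝓘(ℂ, F) ω G M]

theorem mfderiv_inv_smul_surjective {o : M} (hM : IsHomogeneousManifold G E F o) (g : G) :
    Function.Surjective (mfderiv 𝓘(ℂ, E) 𝓘(ℂ, F) (fun k : G ↦ k⁻¹ • g • o) 1) := by
  have h1 : ContMDiff 𝓘(ℂ, E) 𝓘(ℂ, E) ω (fun k : G ↦ k⁻¹ * g) :=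
    contMDiff_mul_right.comp (contMDiff_inv 𝓘(ℂ, E) ω)
  have h2 : ContMDiff 𝓘(ℂ, E) 𝓘(ℂ, E) ω (fun k : G ↦ g * k⁻¹) :=
    contMDiff_mul_left.comp (contMDiff_inv 𝓘(ℂ, E) ω)
  have h3 := mfderiv_comp g (h1.mdifferentiableAt (x := g * g⁻¹) (by simp))
    (h2.mdifferentiableAt (by simp))
  rw [show (fun k : G ↦ k⁻¹ * g) ∘ (fun k : G ↦ g * k⁻¹) = id by ext; simp, mfderiv_id,
    mul_inv_cancel] at h3
  have h4 := mfderiv_comp 1 ((contMDiff_smul_right (E := E) (F := F) o).mdifferentiableAt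
    (x := 1⁻¹ * g) (by simp)) (h1.mdifferentiableAt (by simp))
  rw [show (fun k : G ↦ k • o) ∘ (fun k : G ↦ k⁻¹ * g) = fun k : G ↦ k⁻¹ • g • o by
    ext; simp [mul_smul]] at h4
  intro v
  obtain ⟨Z, hZ⟩ := hM.2 (1⁻¹ * g) v
  refine ⟨mfderiv 𝓘(ℂ, E) 𝓘(ℂ, E) (fun k : G ↦ g * k⁻¹) g Z, ?_⟩
  refine (DFunLike.congr_fun h4 _).trans (Eq.trans ?_ hZ)
  exact congrArg (mfderiv 𝓘(ℂ, E) 𝓘(ℂ, F) (fun k : G ↦ k • o) (1⁻¹ * g))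
    (DFunLike.congr_fun h3 Z).symm

variable [CompleteSpace E] [IsManifold 𝓘(ℂ, F) ω M]

/-- An invariant bidifferential operator is invariant under the action of the Lie algebra. -/
theorem BidiffOp.IsInvariant.lieAct {ν : BidiffOp F M} (hν : ν.IsInvariant E G) {U : Opens M}
    (X : GroupLieAlgebra 𝓘(ℂ, E) G) (a b : HolFun F U) :
    _root_.lieAct X (ν.op U a b) =
      ν.op U (_root_.lieAct X a) b + ν.op U a (_root_.lieAct X b) := by
  have h := hν U (UniversalEnvelopingAlgebra.ι ℂ X) a b
  have h1 : ∀ c : HolFun F U,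
      envRep E G U (UniversalEnvelopingAlgebra.ι ℂ X) c = _root_.lieAct X c := fun c ↦ by
    rw [envRep, UniversalEnvelopingAlgebra.lift_ι_apply]
    rfl
  rw [h1, envComul, UniversalEnvelopingAlgebra.lift_ι_apply] at h
  change _ = TensorProduct.lift _ (UniversalEnvelopingAlgebra.ι ℂ X ⊗ₜ 1 +
    1 ⊗ₜ UniversalEnvelopingAlgebra.ι ℂ X) at h
  rw [map_add, TensorProduct.lift.tmul, TensorProduct.lift.tmul] at h
  have h2 : ∀ c : HolFun F U, envOrbit E G c (UniversalEnvelopingAlgebra.ι ℂ X) =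
      _root_.lieAct X c := h1
  have h3 : ∀ c : HolFun F U, envOrbit E G c 1 = c := fun c ↦ by
    change envRep E G U 1 c = c
    rw [map_one]
    rfl
  rw [LinearMap.compl₁₂_apply, LinearMap.compl₁₂_apply, h2, h2, h3, h3] at h
  exact h

/-- Evaluation of holomorphic functions at a point, as a linear functional. -/
def evalAt {U : Opens M} (y : U) : HolFun F U →ₗ[ℂ] ℂ where
  toFun a := a y
  map_add' _ _ := rfl
  map_smul' _ _ := rfl

/-- Suppose that the isotropy algebra contains an element `h` whose adjoint action is
diagonalizable with integer eigenvalues, the nonnegative part of this grading lying in the sum of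
the isotropy algebra and `𝔫`. Then an invariant bidifferential operator that vanishes on constants
vanishes on the functions constant along the polarization defined by `𝔫`. -/
theorem BidiffOp.op_eq_zero_of_grading [FiniteDimensional ℂ (GroupLieAlgebra 𝓘(ℂ, E) G)]
    {o : M} (hM : IsHomogeneousManifold G E F o)
    {𝔫 : Submodule ℂ (GroupLieAlgebra 𝓘(ℂ, E) G)} {h : GroupLieAlgebra 𝓘(ℂ, E) G}
    (hh : h ∈ isotropySub G E F o)
    (htop : ⨆ d : ℤ, (LieModule.toEnd ℂ (GroupLieAlgebra 𝓘(ℂ, E) G)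
      (GroupLieAlgebra 𝓘(ℂ, E) G) h).eigenspace (d : ℂ) = ⊤)
    (hpos : ∀ d : ℤ, 0 ≤ d → (LieModule.toEnd ℂ (GroupLieAlgebra 𝓘(ℂ, E) G)
      (GroupLieAlgebra 𝓘(ℂ, E) G) h).eigenspace (d : ℂ) ≤ isotropySub G E F o ⊔ 𝔫)
    {ν : BidiffOp F M} (hν : ν.IsInvariant E G) (hν0 : ν.VanishesOnConstants) {U : Opens M}
    {a b : HolFun F U} (ha : a ∈ constantAlong (polarization F o 𝔫) U)
    (hb : b ∈ constantAlong (polarization F o 𝔫) U) : ν.op U a b = 0 := by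
  ext ⟨y, hy⟩
  obtain ⟨g, rfl⟩ := hM.1 y
  obtain ⟨k, hk⟩ := ν.exists_order (g • o)
  set ε : HolFun F U →ₗ[ℂ] ℂ := evalAt ⟨g • o, hy⟩ with hε
  set ρ : GroupLieAlgebra 𝓘(ℂ, E) G →ₗ⁅ℂ⁆ Module.End ℂ (HolFun F U) :=
    (lieRep (E := E) (G := G) U).comp (adHom g) with hρ
  have hε𝔭 : ∀ (𝔫 : Submodule ℂ (GroupLieAlgebra 𝓘(ℂ, E) G)),
      ∀ X ∈ isotropySub G E F o ⊔ 𝔫, ∀ v ∈ constantAlongSubmodule (polarization F o 𝔫) U,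
        ε (ρ X v) = 0 := fun 𝔫 X hX v hv ↦ lieActFun_adLin_eq_zero hv hy hX
  have hiso : ∀ v : HolFun F U, ε (ρ h v) = 0 := by
    -- every function is constant along the polarization defined by the zero subspace
    refine fun v ↦ hε𝔭 ⊥ h (by rwa [sup_bot_eq]) v (mem_constantAlong_iff.2 ?_)
    intro g' _ X hX
    rw [Submodule.mem_bot] at hX
    rw [hX]
    exact map_zero _
  have hword : ∀ l : List (GroupLieAlgebra 𝓘(ℂ, E) G),
      wordAct ρ l = wordAct (lieRep (E := E) (G := G) U) (l.map (adHom g)) := by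
    intro l
    rw [wordAct, wordAct, List.map_map]
    rfl
  have hjet : ∀ v : HolFun F U, (∀ l : List (GroupLieAlgebra 𝓘(ℂ, E) G), l.length ≤ k →
      ε (wordAct ρ l v) = 0) → ∀ i ≤ k, iteratedFDeriv ℂ i
        (v.ext ∘ (extChartAt 𝓘(ℂ, F) (g • o)).symm) (extChartAt 𝓘(ℂ, F) (g • o) (g • o)) = 0 := by
    intro v hv
    refine iteratedFDeriv_eq_zero_of_wordAct hy (mfderiv_inv_smul_surjective hM g) k fun l hl ↦ ?_
    obtain ⟨l, rfl⟩ := (List.map_surjective_iff.2 (adLin_surjective (E := E) g)) l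
    rw [List.length_map] at hl
    have := hv l hl
    rwa [hword] at this
  refine bilin_eq_zero_of_grading (ρ := ρ) (h := h) (ε := ε) (B := (ν.op U).compr₂ ε) (e := 1)
    (C := constantAlongSubmodule (polarization F o 𝔫) U)
    (fun X v hv ↦ lieAct_mem_constantAlong hv (adHom g X)) (hε𝔭 𝔫) htop hpos ?_
    (one_mem_constantAlong _ _) rfl ?_ k ?_ ha hb
  · intro v _ w _
    have h1 := congrArg ε (hν.lieAct (adHom g h) v w)
    rw [map_add] at h1
    exact h1.symm.trans (hiso _)
  · intro v _
    have h1 := hν0 U 1 v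
    rw [map_one] at h1
    simp only [LinearMap.compr₂_apply, h1.1, h1.2, map_zero, and_self]
  · intro v _ hv w _
    exact ⟨hk U hy v w (Or.inl (hjet v hv)), hk U hy w v (Or.inr (hjet v hv))⟩

end Vanishing

end

theorem mainTheorem8 {E F G M : Type*}
    [NormedAddCommGroup E] [NormedSpace ℂ E] [FiniteDimensional ℂ E]
    [NormedAddCommGroup F] [NormedSpace ℂ F] [FiniteDimensional ℂ F]
    [TopologicalSpace G] [ChartedSpace E G] [Group G] [LieGroup 𝓘(ℂ, E) ω G]
    [T2Space G] [ConnectedSpace G]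
    [LieAlgebra.IsSimple ℂ (GroupLieAlgebra 𝓘(ℂ, E) G)]
    [TopologicalSpace M] [ChartedSpace F M] [IsManifold 𝓘(ℂ, F) ω M] [T2Space M]
    [MulAction G M] [ContMDiffSMul 𝓘(ℂ, E) 𝓘(ℂ, F) ω G M]
    (o : M) (hM : IsHomogeneousManifold G E F o)
    (hL : IsConnected (MulAction.stabilizer G o : Set G))
    (H : LieSubalgebra ℂ (GroupLieAlgebra 𝓘(ℂ, E) G)) [H.IsCartanSubalgebra]
    (𝔩 : LieSubalgebra ℂ (GroupLieAlgebra 𝓘(ℂ, E) G))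
    (h𝔩 : 𝔩.toSubmodule = isotropySub G E F o) (hLevi : IsLeviSubalgebra H 𝔩)
    (Y : Set (QuasirootSpace H 𝔩)) (hY : IsPositiveSystem H 𝔩 Y) :
    (∀ ν : BidiffOp F M, ν.IsInvariant E G → ν.VanishesOnConstants →
      ∀ U : Opens M, ∀ a ∈ constantAlong (polarization F o (mPlus H 𝔩 Y)) U,
        ∀ b ∈ constantAlong (polarization F o (mPlus H 𝔩 Y)) U, ν.op U a b = 0) ∧
    (∀ (Φ : (EnvAlg E G ⊗[ℂ] (EnvAlg E G ⊗[ℂ] EnvAlg E G))⟦X⟧)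
      (μ : PhiQuantization E G F M Φ), μ.IsInvariant →
      ∀ U : Opens M, ∀ a ∈ constantAlong (polarization F o (mPlus H 𝔩 Y)) U,
        ∀ b ∈ constantAlong (polarization F o (mPlus H 𝔩 Y)) U,
          μ.mul U (PowerSeries.C a) (PowerSeries.C b) = PowerSeries.C (a * b)) := by
  have hfin : FiniteDimensional ℂ (GroupLieAlgebra 𝓘(ℂ, E) G) :=
    inferInstanceAs (FiniteDimensional ℂ E)
  obtain ⟨h, hh, htop, hpos⟩ := exists_gradingElement H hLevi hY
  rw [h𝔩] at hpos
  have main : ∀ ν : BidiffOp F M, ν.IsInvariant E G → ν.VanishesOnConstants →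
      ∀ U : Opens M, ∀ a ∈ constantAlong (polarization F o (mPlus H 𝔩 Y)) U,
        ∀ b ∈ constantAlong (polarization F o (mPlus H 𝔩 Y)) U, ν.op U a b = 0 :=
    fun ν hν hν0 U a ha b hb ↦
      ν.op_eq_zero_of_grading hM (h𝔩 ▸ hh) htop hpos hν hν0 ha hb
  refine ⟨main, fun Φ μ hμ U a ha b hb ↦ ?_⟩
  rw [μ.mul_eq]
  ext1 k
  rw [PowerSeries.coeff_mk, PowerSeries.coeff_C]
  split_ifs with hk
  · rw [hk, μ.term_zero]
  · exact main _ (hμ k) (μ.term_vanishes k (Nat.pos_of_ne_zero hk)) U a ha b hb
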